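/- **Setting.** Let $d,T\ge 1$ be integers and $L>0$. Let $F:\mathbb R^d\times\Xi\to\mathbb R$ be jointly measurable, let $\xi$ be a random variable with values in $\Xi$, suppose that $F(x;\xi)$ is integrable for every $x$, and put $f(x)=\mathbb E_\xi[F(x;\xi)]$. Assume that 1. $F(\cdot\,;\xi)$ is $L$-Lipschitz on $\mathbb R^d$ for almost every $\xi$; 2. $f$ is $\mu$-smooth, i.e. differentiable with $\|\nabla f(x)-\nabla f(y)\|\le\mu\|x-y\|$ for all $x,y\in\mathbb R^d$; 3. $f$ is bounded below, with $f(x_0)-\inf f\le\Delta$. **Algorithm (LAZO without projection).** Let $u_0,u_1,\dots$ be uniform on the unit sphere of $\mathbb R^d$ and let $\xi_0,\xi_1,\dots$ be copies of $\xi$, all of them independent. Put $f_t(x)=F(x;\xi_t)$ and, given $x_0\in\mathbb R^d$ and $\eta,\delta,D>0$, let $w_t=x_t+\delta u_t$ and $x_{t+1}=x_t-\eta\,\tilde g_t$. Here $\tilde g_0=\frac{d}{2\delta}\big(f_0(w_0)-f_0(x_0-\delta u_0)\big)u_0$ and, for $t\ge1$, $$\tilde g_t=\begin{cases}\frac{d}{\delta}\big(f_t(w_t)-f_{t-1}(w_{t-1})\big)u_t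 & \text{if } D_t(w_t,w_{t-1})\le D,\\[2pt] \frac{d}{2\delta}\big(f_t(w_t)-f_t(x_t-\delta u_t)\big)u_t&\text{otherwise,}\end{cases}$$ where $D_t(x,y)=|f_t(x)-f_{t-1}(y)|/\|x-y\|$ for LAZOa (with $0/0=0$ and $a/0=+\infty$ for $a>0$) and $D_t(x,y)=|f_t(x)-f_{t-1}(y)|/(\eta L)$ for LAZOb. For $t\ge1$, with everything but the direction at time $t$ fixed, let $A_t$ be the set of all directions $u$ such that $D_t(x_t+\delta u,w_{t-1})\le D$, and let $A_t^s$ be the largest subset of $A_t$ that is symmetric under $u\mapsto-u$. **Theorem.** Let $\eta=\frac1{L\sqrt{dT}}$ and $\delta=\sqrt{d/T}$. Suppose that $\sum_{t=1}^T\mathbb P(u_t\in A_t\setminus A_t^s)\le c_A\sqrt{T/d}$, and that $0<D\le c_D L/\sqrt d$ and $D<L/\sqrt{10}$ for LAZOa, or $0<D\le c_D\sqrt d\,L$ for LAZOb. Then there are constants $C,K$ that depend only on $L,\mu,\Delta,c_A,c_D$ (and not on $d$, $T$ or the problem) such that, for LAZOa and for LAZOb, $$\sum_{t=0}^T\mathbb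 E\big[\|\nabla f(x_t)\|^2\big]\le C\sqrt{dT},$$ and, for every $\varepsilon>0$, $\frac1T\sum_{t=0}^T\mathbb E[\|\nabla f(x_t)\|^2]\le\varepsilon$ as soon as $T\ge K d\,\varepsilon^{-2}$; that is, the iteration complexity is $O(d\varepsilon^{-2})$. -/

import Mathlib

namespace LAZO

open MeasureTheory ProbabilityTheory
open scoped ENNReal

noncomputable section

/-- The space `ℝ^d` with the Euclidean norm. -/
abbrev E (d : ℕ) : Type := EuclideanSpace ℝ (Fin d)

/-- The uniform distribution on the Euclidean unit sphere of `ℝ^d` (for `1 ≤ d`), as a measure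
on `ℝ^d`: the normalized surface measure. -/
def uniformSphere (d : ℕ) : Measure (E d) :=
  (((volume : Measure (E d)).toSphere Set.univ)⁻¹ • (volume : Measure (E d)).toSphere).map
    Subtype.val

theorem isProbabilityMeasure_uniformSphere (d : ℕ) (hd : 1 ≤ d) :
    IsProbabilityMeasure (uniformSphere d) := by
  have : Nonempty (Fin d) := ⟨⟨0, hd⟩⟩
  have : Nontrivial (E d) := inferInstance
  refine ⟨?_⟩
  rw [uniformSphere, Measure.map_apply measurable_subtype_coe MeasurableSet.univ]
  simp only [Set.preimage_univ, Measure.smul_apply, smul_eq_mul]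
  exact ENNReal.inv_mul_cancel
    (by rw [Ne, Measure.measure_univ_eq_zero]; exact Measure.toSphere_ne_zero _)
    (measure_ne_top _ _)

/-! ### Objective and sampling -/

/-- The objective `f(x) = 𝔼_ξ[F(x; ξ)]`, where `ν` is the law of `ξ`. -/
def objective {d : ℕ} {Ξ : Type*} [MeasurableSpace Ξ] (ν : Measure Ξ) (F : E d → Ξ → ℝ)
    (x : E d) : ℝ :=
  ∫ z, F x z ∂ν

/-- `f` is `μ`-smooth: differentiable with a `μ`-Lipschitz gradient. -/
def IsSmooth {d : ℕ} (μ : ℝ) (f : E d → ℝ) : Prop :=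
  Differentiable ℝ f ∧ ∀ x y, ‖gradient f x - gradient f y‖ ≤ μ * ‖x - y‖

/-- The random inputs of the algorithm: the pairs `(u_t, ξ_t)` are independent over `t`, and for
each `t` the direction `u_t` is uniform on the unit sphere, `ξ_t` has law `ν`, and `u_t` and `ξ_t`
are independent. -/
structure IsSampling {d : ℕ} {Ω Ξ : Type*} [MeasurableSpace Ω] [MeasurableSpace Ξ]
    (P : Measure Ω) (ν : Measure Ξ) (u : ℕ → Ω → E d) (ξ : ℕ → Ω → Ξ) : Prop where
  measurable_u : ∀ t, Measurable (u t)
  measurable_ξ : ∀ t, Measurable (ξ t)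
  indep : iIndepFun (fun t ω => (u t ω, ξ t ω)) P
  law : ∀ t, P.map (fun ω => (u t ω, ξ t ω)) = (uniformSphere d).prod ν

/-! ### Gradient estimators -/

/-- One-point residual estimator `(d u / δ) (f(x + δ u) - q)`, where `q` is the value of the
previous query. -/
def onePoint {d : ℕ} (δ : ℝ) (f : E d → ℝ) (q : ℝ) (x u : E d) : E d :=
  ((d : ℝ) / δ * (f (x + δ • u) - q)) • u

/-- Symmetric two-point estimator `(d u / (2 δ)) (f(x + δ u) - f(x - δ u))`. -/
def twoPoint {d : ℕ} (δ : ℝ) (f : E d → ℝ) (x u : E d) : E d :=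
  ((d : ℝ) / (2 * δ) * (f (x + δ • u) - f (x - δ • u))) • u

/-- A temporal variation: a quantity `V f g x y` that compares the value of the present loss `f`
at `x` with the value of the previous loss `g` at `y`. -/
abbrev Variation (d : ℕ) : Type := (E d → ℝ) → (E d → ℝ) → E d → E d → ℝ≥0∞

/-- The variation `D^a(x, y) = |f x - g y| / ‖x - y‖`, with values in `[0, ∞]`: if `x = y` it is
`∞` when `f x ≠ g y`, and `0` when `f x = g y`. -/
def variationA (d : ℕ) : Variation d := fun f g x y =>
  ENNReal.ofReal |f x - g y| / ENNReal.ofReal ‖x - y‖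

/-- The variation `D^b(x, y) = |f x - g y| / (η L)`. -/
def variationB (d : ℕ) (η L : ℝ) : Variation d := fun f g x y =>
  ENNReal.ofReal |f x - g y| / ENNReal.ofReal (η * L)

/-- The set `A_t` of those directions `u` for which the lazy (one-point) query is used: the
temporal variation at `w_t = x + δ u` and `w_{t-1} = x' + δ u'` is at most `D`. Here `f`, `x` are
the present loss and iterate, and `g`, `x'`, `u'` the previous loss, iterate and direction. -/
def lazySet {d : ℕ} (V : Variation d) (δ D : ℝ) (f g : E d → ℝ) (x x' u' : E d) : Set (E d) :=
  {u | V f g (x + δ • u) (x' + δ • u') ≤ ENNReal.ofReal D}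

open Classical in
/-- The LAZO estimator at a time `t ≥ 1`: one-point residual if the direction `u` lies in the lazy
set, and two-point otherwise. -/
def estimator {d : ℕ} (V : Variation d) (δ D : ℝ) (f g : E d → ℝ) (x x' u u' : E d) : E d :=
  if u ∈ lazySet V δ D f g x x' u' then onePoint δ f (g (x' + δ • u')) x u else twoPoint δ f x u

/-- The iterates `x_t` of LAZO without projection, `x_{t+1} = x_t - η g_t`, where `g_0` is the
two-point estimator and `g_t` is the LAZO estimator for `t ≥ 1`, and where the loss at time `t`
is `F(·; ξ_t)`. -/
def iterates {d : ℕ} {Ξ : Type*} (V : Variation d) (F : E d → Ξ → ℝ) (η δ D : ℝ) (x₀ : E d)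
    (u : ℕ → E d) (ξ : ℕ → Ξ) : ℕ → E d
  | 0 => x₀
  | 1 => x₀ - η • twoPoint δ (fun x => F x (ξ 0)) x₀ (u 0)
  | t + 2 =>
    iterates V F η δ D x₀ u ξ (t + 1) -
      η • estimator V δ D (fun x => F x (ξ (t + 1))) (fun x => F x (ξ t))
        (iterates V F η δ D x₀ u ξ (t + 1)) (iterates V F η δ D x₀ u ξ t) (u (t + 1)) (u t)

/-- The lazy set `A_{t+1}` along a run of the algorithm; it is determined by the past
and by `ξ_{t+1}`, but not by `u_{t+1}`. -/
def runLazySet {d : ℕ} {Ξ : Type*} (V : Variation d) (F : E d → Ξ → ℝ) (η δ D : ℝ) (x₀ : E d)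
    (u : ℕ → E d) (ξ : ℕ → Ξ) (t : ℕ) : Set (E d) :=
  lazySet V δ D (fun x => F x (ξ (t + 1))) (fun x => F x (ξ t))
    (iterates V F η δ D x₀ u ξ (t + 1)) (iterates V F η δ D x₀ u ξ t) (u t)

/-- The largest subset of `A` that is symmetric under `u ↦ -u`: the union of all of them. -/
def symmPart {d : ℕ} (A : Set (E d)) : Set (E d) :=
  ⋃₀ {B | B ⊆ A ∧ ∀ u, u ∈ B ↔ -u ∈ B}

theorem mem_symmPart_iff {d : ℕ} (A : Set (E d)) (u : E d) :
    u ∈ symmPart A ↔ u ∈ A ∧ -u ∈ A := by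
  constructor
  · rintro ⟨B, ⟨hBA, hB⟩, hu⟩
    exact ⟨hBA hu, hBA ((hB u).1 hu)⟩
  · rintro ⟨h1, h2⟩
    refine ⟨{v | v ∈ A ∧ -v ∈ A}, ⟨fun v hv => hv.1, fun v => ?_⟩, h1, h2⟩
    simp only [Set.mem_ofPred_eq, neg_neg]
    exact and_comm

/-- The total asymmetry `∑_{t=1}^{T} ℙ(u_t ∈ A_t \ A_t^s)` of the lazy sets, where `A_t^s` is the
largest symmetric subset of `A_t`. (At `t = 0` no lazy query is possible.) -/
def totalAsymmetry {d : ℕ} {Ω Ξ : Type*} [MeasurableSpace Ω] (P : Measure Ω) (V : Variation d)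
    (F : E d → Ξ → ℝ) (η δ D : ℝ) (x₀ : E d) (u : ℕ → Ω → E d) (ξ : ℕ → Ω → Ξ) (T : ℕ) : ℝ :=
  ∑ t ∈ Finset.range T, P.real {ω |
    u (t + 1) ω ∈ runLazySet V F η δ D x₀ (fun s => u s ω) (fun s => ξ s ω) t \
      symmPart (runLazySet V F η δ D x₀ (fun s => u s ω) (fun s => ξ s ω) t)}

/-- The squared gradient norm `‖∇f(x_t)‖²` along the run. -/
def gradSq {d : ℕ} {Ω Ξ : Type*} [MeasurableSpace Ξ] (ν : Measure Ξ) (V : Variation d)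
    (F : E d → Ξ → ℝ) (η δ D : ℝ) (x₀ : E d) (u : ℕ → Ω → E d) (ξ : ℕ → Ω → Ξ) (t : ℕ)
    (ω : Ω) : ℝ :=
  ‖gradient (objective ν F)
    (iterates V F η δ D x₀ (fun s => u s ω) (fun s => ξ s ω) t)‖ ^ 2

/-- The nonconvex regret `∑_{t=0}^{T} 𝔼 ‖∇f(x_t)‖²`. -/
def ncRegret {d : ℕ} {Ω Ξ : Type*} [MeasurableSpace Ω] [MeasurableSpace Ξ] (P : Measure Ω)
    (ν : Measure Ξ) (V : Variation d) (F : E d → Ξ → ℝ) (η δ D : ℝ) (x₀ : E d)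
    (u : ℕ → Ω → E d) (ξ : ℕ → Ω → Ξ) (T : ℕ) : ℝ :=
  ∑ t ∈ Finset.range (T + 1), ∫ ω, gradSq ν V F η δ D x₀ u ξ t ω ∂P

/-- The conclusion for one run of LAZO with variation `V`: each `‖∇f(x_t)‖²` is integrable, the
regret is at most `C √(dT)`, and the average `regret / T` is at most `ε` as soon as
`T ≥ K d ε⁻²`. -/
def RegretBound {d : ℕ} {Ω Ξ : Type*} [MeasurableSpace Ω] [MeasurableSpace Ξ] (P : Measure Ω)
    (ν : Measure Ξ) (V : Variation d) (F : E d → Ξ → ℝ) (η δ D : ℝ) (x₀ : E d)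
    (u : ℕ → Ω → E d) (ξ : ℕ → Ω → Ξ) (T : ℕ) (C K : ℝ) : Prop :=
  (∀ t ≤ T, Integrable (gradSq ν V F η δ D x₀ u ξ t) P) ∧
  ncRegret P ν V F η δ D x₀ u ξ T ≤ C * √((d : ℝ) * T) ∧
  ∀ ε : ℝ, 0 < ε → K * (d : ℝ) / ε ^ 2 ≤ T → ncRegret P ν V F η δ D x₀ u ξ T / T ≤ ε

end

end LAZO

/-!
The proof is the descent argument for stochastic gradient methods. Since `f` is smooth, one step
changes `f(x_t)` by at most `-η ⟪∇f(x_t), g_t⟫ + M η² ‖g_t‖²`, and the sum over `t` telescopes; so it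
suffices to bound `𝔼 ⟪∇f(x_t), g_t⟫` from below and `𝔼 ‖g_t‖²` from above, with the right dependence on
`d`. If `T < d`, then `‖∇f‖ ≤ L` is enough.

*Dimension dependence.* Everything rests on `integral_sq_antipodal_le`: for a `K`-Lipschitz function
`φ`, the mean of `(φ(u) - φ(-u))²` over the unit sphere is `O(K² / d)`. It gives
`𝔼 ‖g‖² = O(d L²)` for the two-point estimator. Applied to the first-order remainder of `f` on a
sphere of radius `δ`, which is `M δ²`-Lipschitz, and combined with the Cauchy–Schwarz inequality, it
also shows that the bias of the two-point estimator is `O(M δ)`, without the divergence theorem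
(`IsSmooth.twoPoint_bias`). The bound on the sphere comes from a Gaussian one: extend the odd
function `φ(u) - φ(-u)` to a function that is positively homogeneous of degree one, which is again
Lipschitz, and use polar coordinates. For independent standard Gaussian vectors `x`, `y`, the curve
`cos θ • x + sin θ • y` leads from `x` to `-x` in half a turn, and the joint law of position and
velocity is constant along it. Cutting the half turn into `n` equal steps and letting `n → ∞`,
with Rademacher's theorem for the derivative, bounds `𝔼 (φ(x) - φ(-x))²` by
`π² 𝔼 ⟪∇φ(x), y⟫² = π² 𝔼 ‖∇φ(x)‖²` (`integral_sq_sub_neg_le_of_lipschitz`).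

*Lazy queries.* On the symmetric part of the lazy set, the difference between the one-point and the
two-point estimator is odd in the direction, hence has mean zero
(`integral_symmetric_part_eq_zero`). The asymmetric part contributes at most its probability times
the almost sure bound `O(d L)` on the estimators. If the temporal variation is small, then
the norm of the one-point estimator is at most `a ‖g_{t-1}‖ + β` with `10 a² ≤ 1` and
`β = O(L √d)` (`LazyControl`), so the second moments satisfy a contracting recursion. The two
variations differ only in the values of `a` and `β`.

A run is described by a `State` that is driven by the inputs `(u_t, ξ_t)`, and is therefore
independent of the present input; expectations at time `t` become integrals over a product measure.
-/

namespace LAZO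

open MeasureTheory ProbabilityTheory
open scoped ENNReal NNReal Topology RealInnerProductSpace

noncomputable section

/-! ### The standard Gaussian measure -/

section Gaussian

variable {V : Type*} [NormedAddCommGroup V] [InnerProductSpace ℝ V]

/-- The point at angle `θ` of the great circle through `p.1` (at angle `0`) and `p.2` (at angle
`π / 2`). -/
def circlePoint (θ : ℝ) (p : V × V) : V := Real.cos θ • p.1 + Real.sin θ • p.2

theorem circlePoint_add (α h : ℝ) (p : V × V) :
    circlePoint (α + h) p = circlePoint h (ContinuousLinearMap.rotation α p) := by
  simp only [circlePoint, ContinuousLinearMap.rotation_apply, Real.cos_add, Real.sin_add]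
  module

theorem continuous_circlePoint (θ : ℝ) : Continuous (circlePoint θ : V × V → V) := by
  unfold circlePoint; fun_prop

theorem norm_circlePoint_sub_le (θ : ℝ) (p : V × V) :
    ‖circlePoint θ p - p.1‖ ≤ |θ| * (‖p.1‖ + ‖p.2‖) := by
  have h1 : circlePoint θ p - p.1 = (Real.cos θ - 1) • p.1 + Real.sin θ • p.2 := by
    simp only [circlePoint]; module
  have h2 : |Real.cos θ - 1| ≤ |θ| := by
    have := Real.abs_cos_sub_cos_le θ 0
    simpa using this
  rw [h1]
  refine (norm_add_le _ _).trans ?_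
  rw [norm_smul, norm_smul, Real.norm_eq_abs, Real.norm_eq_abs, mul_add]
  exact add_le_add (mul_le_mul_of_nonneg_right h2 (norm_nonneg _))
    (mul_le_mul_of_nonneg_right Real.abs_sin_le_abs (norm_nonneg _))

variable (V) in
/-- The density of the standard Gaussian measure of `V`, as a function of the norm. -/
def gaussianDensity (r : ℝ) : ℝ≥0 :=
  Real.toNNReal (((2 * Real.pi) ^ (Module.finrank ℝ V / 2 : ℝ))⁻¹ * Real.exp (-(1 / 2) * r ^ 2))

theorem coe_gaussianDensity (r : ℝ) : (gaussianDensity V r : ℝ) =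
    ((2 * Real.pi) ^ (Module.finrank ℝ V / 2 : ℝ))⁻¹ * Real.exp (-(1 / 2) * r ^ 2) :=
  Real.coe_toNNReal _ (by positivity)

theorem measurable_gaussianDensity : Measurable (gaussianDensity V) := by
  unfold gaussianDensity; fun_prop

variable [FiniteDimensional ℝ V] [MeasurableSpace V] [BorelSpace V]

theorem stdGaussian_eq_withDensity :
    stdGaussian V = (volume : Measure V).withDensity (fun x => (gaussianDensity V ‖x‖ : ℝ≥0∞)) := by
  have hm : Measurable (fun x : V => gaussianDensity V ‖x‖) :=
    measurable_gaussianDensity.comp measurable_norm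
  have hint : Integrable (fun x : V => (gaussianDensity V ‖x‖ : ℝ)) volume := by
    have h := GaussianFourier.integrable_cexp_neg_mul_sq_norm_add (b := (1 / 2 : ℂ))
      (by norm_num) 0 (0 : V)
    have h2 := h.re.const_mul ((2 * Real.pi) ^ (Module.finrank ℝ V / 2 : ℝ))⁻¹
    refine h2.congr (ae_of_all _ fun x => ?_)
    dsimp only
    rw [coe_gaussianDensity]
    congr 1
    simp only [inner_zero_left, zero_mul, add_zero, RCLike.re_to_complex]
    have : (-(1 / 2 : ℂ) * (‖x‖ : ℂ) ^ 2) = ((-(1 / 2) * ‖x‖ ^ 2 : ℝ) : ℂ) := by push_cast; ring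
    rw [this, Complex.exp_ofReal_re]
  have : IsFiniteMeasure ((volume : Measure V).withDensity
      (fun x => (gaussianDensity V ‖x‖ : ℝ≥0∞))) := by
    refine isFiniteMeasure_withDensity ?_
    have := hint.lintegral_lt_top
    simpa using this.ne
  refine Measure.ext_of_charFun (funext fun t => ?_)
  rw [charFun_stdGaussian, charFun_apply, integral_withDensity_eq_integral_smul hm]
  have key : ∀ x : V, gaussianDensity V ‖x‖ • Complex.exp (⟪x, t⟫ * Complex.I) =
      (((2 * Real.pi) ^ (Module.finrank ℝ V / 2 : ℝ))⁻¹ : ℝ) *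
        Complex.exp (-(1 / 2 : ℂ) * ‖x‖ ^ 2 + Complex.I * ⟪t, x⟫) := by
    intro x
    rw [NNReal.smul_def, coe_gaussianDensity, Complex.real_smul, Complex.exp_add,
      real_inner_comm, mul_comm Complex.I]
    push_cast
    ring
  simp_rw [key]
  rw [integral_const_mul, GaussianFourier.integral_cexp_neg_mul_sq_norm_add (by norm_num)]
  have h1 : ((Real.pi : ℂ) / (1 / 2)) ^ (Module.finrank ℝ V / 2 : ℂ) =
      (((2 * Real.pi) ^ (Module.finrank ℝ V / 2 : ℝ) : ℝ) : ℂ) := by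
    rw [Complex.ofReal_cpow (by positivity)]
    push_cast
    congr 1
    ring
  rw [h1, ← mul_assoc, ← Complex.ofReal_mul, inv_mul_cancel₀ (by positivity)]
  rw [Complex.I_sq]
  norm_num

theorem stdGaussian_absolutelyContinuous : stdGaussian V ≪ volume := by
  rw [stdGaussian_eq_withDensity]
  exact withDensity_absolutelyContinuous _ _

theorem map_neg_stdGaussian : (stdGaussian V).map (fun x => -x) = stdGaussian V :=
  stdGaussian_map (LinearIsometryEquiv.neg ℝ)

theorem integrable_norm_sq_stdGaussian : Integrable (fun x : V => ‖x‖ ^ 2) (stdGaussian V) := by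
  simpa using (IsGaussian.memLp_two_id (μ := stdGaussian V)).integrable_norm_pow (by norm_num)

theorem integral_sq_dual_stdGaussian (l : StrongDual ℝ V) :
    ∫ x, l x ^ 2 ∂(stdGaussian V) = ‖l‖ ^ 2 := by
  rw [← variance_dual_stdGaussian,
    variance_of_integral_eq_zero l.continuous.aemeasurable (integral_strongDual_stdGaussian l)]

theorem integral_inner_sq_stdGaussian (a : V) :
    ∫ x, ⟪a, x⟫ ^ 2 ∂(stdGaussian V) = ‖a‖ ^ 2 := by
  simpa using integral_sq_dual_stdGaussian (innerSL ℝ a)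

theorem integral_norm_sq_stdGaussian :
    ∫ x : V, ‖x‖ ^ 2 ∂(stdGaussian V) = Module.finrank ℝ V := by
  have h : ∀ x : V, ‖x‖ ^ 2 = ∑ i, ⟪stdOrthonormalBasis ℝ V i, x⟫ ^ 2 := fun x =>
    ((stdOrthonormalBasis ℝ V).sum_sq_inner_right x).symm
  simp_rw [h]
  rw [integral_finsetSum]
  · simp [integral_inner_sq_stdGaussian]
  · intro i _
    refine integrable_norm_sq_stdGaussian.mono' (by fun_prop) (ae_of_all _ fun x => ?_)
    rw [Real.norm_of_nonneg (sq_nonneg _)]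
    have := abs_real_inner_le_norm (stdOrthonormalBasis ℝ V i) x
    rw [← sq_abs]
    gcongr
    simpa using this

theorem integral_comp_rotation_stdGaussian (α : ℝ) (f : V × V → ℝ) (hf : Continuous f) :
    ∫ p, f (ContinuousLinearMap.rotation α p) ∂((stdGaussian V).prod (stdGaussian V)) =
      ∫ p, f p ∂((stdGaussian V).prod (stdGaussian V)) := by
  conv_rhs => rw [← IsGaussian.map_rotation_eq_self (μ := stdGaussian V) integral_id_stdGaussian α]
  rw [integral_map (by fun_prop) hf.aestronglyMeasurable]

theorem integrable_sq_norm_add_prod_stdGaussian :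
    Integrable (fun p : V × V => (‖p.1‖ + ‖p.2‖) ^ 2) ((stdGaussian V).prod (stdGaussian V)) := by
  have h1 := (integrable_norm_sq_stdGaussian (V := V)).comp_fst (stdGaussian V)
  have h2 := (integrable_norm_sq_stdGaussian (V := V)).comp_snd (stdGaussian V)
  refine ((h1.add h2).const_mul 2).mono' (by fun_prop) (ae_of_all _ fun p => ?_)
  rw [Real.norm_of_nonneg (sq_nonneg _)]
  simp only [Pi.add_apply]
  nlinarith [sq_nonneg (‖p.1‖ - ‖p.2‖)]

theorem integrable_sq_sub_of_lipschitz {φ : V → ℝ} {K : ℝ≥0} (hφ : LipschitzWith K φ)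
    (c θ : ℝ) : Integrable (fun p : V × V => (c * (φ (circlePoint θ p) - φ p.1)) ^ 2)
      ((stdGaussian V).prod (stdGaussian V)) := by
  have hc : Continuous (fun p : V × V => (c * (φ (circlePoint θ p) - φ p.1)) ^ 2) :=
    (continuous_const.mul ((hφ.continuous.comp (continuous_circlePoint θ)).sub
      (hφ.continuous.comp continuous_fst))).pow 2
  refine (integrable_sq_norm_add_prod_stdGaussian.const_mul ((|c| * K * |θ|) ^ 2)).mono'
    hc.aestronglyMeasurable (ae_of_all _ fun p => ?_)
  rw [Real.norm_of_nonneg (sq_nonneg _), ← mul_pow, ← sq_abs, abs_mul]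
  have h := hφ.dist_le_mul (circlePoint θ p) p.1
  rw [Real.dist_eq, dist_eq_norm] at h
  have h' := norm_circlePoint_sub_le θ p
  gcongr ?_ ^ 2
  calc |c| * |φ (circlePoint θ p) - φ p.1| ≤ |c| * (K * (|θ| * (‖p.1‖ + ‖p.2‖))) := by
        gcongr; exact h.trans (by gcongr)
    _ = _ := by ring

/-- Half a turn is the sum of `n` rotations by `π / n`, which all preserve the product measure, so
that the mean square of the total increment is at most `n²` times that of the first one. -/
theorem integral_sq_sub_neg_le_step {φ : V → ℝ} {K : ℝ≥0} (hφ : LipschitzWith K φ) (n : ℕ)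
    (hn : n ≠ 0) :
    ∫ x, (φ x - φ (-x)) ^ 2 ∂(stdGaussian V) ≤
      ∫ p, (n * (φ (circlePoint (Real.pi / n) p) - φ p.1)) ^ 2
        ∂((stdGaussian V).prod (stdGaussian V)) := by
  set Γ := (stdGaussian V).prod (stdGaussian V)
  set h : ℝ := Real.pi / n with hh
  have hn' : (n : ℝ) ≠ 0 := by exact_mod_cast hn
  have hcont : Continuous (fun p : V × V => (φ (circlePoint h p) - φ p.1) ^ 2) :=
    ((hφ.continuous.comp (continuous_circlePoint h)).sub
      (hφ.continuous.comp continuous_fst)).pow 2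
  have hfst : ∀ (α : ℝ) (p : V × V), (ContinuousLinearMap.rotation α p).1 = circlePoint α p :=
    fun α p => rfl
  have hincr : ∀ k : ℕ, ∀ p : V × V, (φ (circlePoint ((k + 1 : ℕ) * h) p) -
      φ (circlePoint (k * h) p)) ^ 2 = (fun p : V × V => (φ (circlePoint h p) - φ p.1) ^ 2)
        (ContinuousLinearMap.rotation (k * h) p) := by
    intro k p
    simp only [hfst, ← circlePoint_add]
    congr 4
    push_cast; ring
  have hint1 : Integrable (fun p : V × V => (φ (circlePoint h p) - φ p.1) ^ 2) Γ := by
    simpa using integrable_sq_sub_of_lipschitz hφ 1 h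
  have hintk : ∀ k : ℕ, Integrable (fun p : V × V => (φ (circlePoint ((k + 1 : ℕ) * h) p) -
      φ (circlePoint (k * h) p)) ^ 2) Γ := by
    intro k
    simp_rw [hincr k]
    have hmp : MeasurePreserving (ContinuousLinearMap.rotation (k * h) : V × V → V × V) Γ Γ :=
      ⟨by fun_prop, IsGaussian.map_rotation_eq_self integral_id_stdGaussian _⟩
    exact hmp.integrable_comp_of_integrable hint1
  have hpt : ∀ p : V × V, (φ p.1 - φ (-p.1)) ^ 2 ≤ n * ∑ k ∈ Finset.range n,
      (φ (circlePoint ((k + 1 : ℕ) * h) p) - φ (circlePoint (k * h) p)) ^ 2 := by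
    intro p
    have htel := Finset.sum_range_sub (fun k : ℕ => φ (circlePoint (k * h) p)) n
    have h0 : circlePoint ((0 : ℕ) * h) p = p.1 := by simp [circlePoint]
    have hN : circlePoint (n * h) p = -p.1 := by
      rw [hh, mul_div_cancel₀ _ hn']; simp [circlePoint]
    rw [h0, hN] at htel
    have := sq_sum_le_card_mul_sum_sq (s := Finset.range n)
      (f := fun k : ℕ => φ (circlePoint ((k + 1 : ℕ) * h) p) - φ (circlePoint (k * h) p))
    rw [htel, Finset.card_range] at this
    calc (φ p.1 - φ (-p.1)) ^ 2 = (φ (-p.1) - φ p.1) ^ 2 := by ring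
      _ ≤ _ := this
  calc ∫ x, (φ x - φ (-x)) ^ 2 ∂(stdGaussian V) = ∫ p, (φ p.1 - φ (-p.1)) ^ 2 ∂Γ := by
        rw [integral_fun_fst (fun x => (φ x - φ (-x)) ^ 2)]; simp
    _ ≤ ∫ p, n * ∑ k ∈ Finset.range n,
      (φ (circlePoint ((k + 1 : ℕ) * h) p) - φ (circlePoint (k * h) p)) ^ 2 ∂Γ := by
        refine integral_mono_of_nonneg (ae_of_all _ fun p => sq_nonneg _)
          ((integrable_finsetSum _ fun k _ => hintk k).const_mul _) (ae_of_all _ hpt)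
    _ = n * ∑ k ∈ Finset.range n, ∫ p, (φ (circlePoint h p) - φ p.1) ^ 2 ∂Γ := by
        rw [integral_const_mul, integral_finsetSum _ fun k _ => hintk k]
        congr 1
        refine Finset.sum_congr rfl fun k _ => ?_
        simp_rw [hincr k]
        exact integral_comp_rotation_stdGaussian _ _ hcont
    _ = _ := by
        simp_rw [mul_pow]
        rw [integral_const_mul, Finset.sum_const, Finset.card_range, nsmul_eq_mul]
        ring

/-- A Poincaré inequality for the odd part of a Lipschitz function. The point on a random great
circle moves from `x` to `-x` while its position and velocity remain independent Gaussian
vectors. -/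
theorem integral_sq_sub_neg_le_of_lipschitz {φ : V → ℝ} {K : ℝ≥0} (hφ : LipschitzWith K φ) :
    ∫ x, (φ x - φ (-x)) ^ 2 ∂(stdGaussian V) ≤ Real.pi ^ 2 * K ^ 2 := by
  set Γ := (stdGaussian V).prod (stdGaussian V)
  have hdiff : ∀ᵐ p ∂Γ, DifferentiableAt ℝ φ p.1 :=
    Measure.quasiMeasurePreserving_fst.ae
      (stdGaussian_absolutelyContinuous.ae_le hφ.ae_differentiableAt)
  have hlim : Filter.Tendsto (fun n : ℕ => ∫ p, (((n + 1 : ℕ) : ℝ) *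
      (φ (circlePoint (Real.pi / (n + 1 : ℕ)) p) - φ p.1)) ^ 2 ∂Γ) Filter.atTop
      (𝓝 (∫ p, (Real.pi * fderiv ℝ φ p.1 p.2) ^ 2 ∂Γ)) := by
    refine tendsto_integral_of_dominated_convergence
      (fun p => (Real.pi * K) ^ 2 * (‖p.1‖ + ‖p.2‖) ^ 2) (fun n => ?_)
      (integrable_sq_norm_add_prod_stdGaussian.const_mul _) (fun n => ae_of_all _ fun p => ?_) ?_
    · exact (integrable_sq_sub_of_lipschitz hφ _ _).aestronglyMeasurable
    · rw [Real.norm_of_nonneg (sq_nonneg _), ← mul_pow, ← sq_abs, abs_mul]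
      have h := hφ.dist_le_mul (circlePoint (Real.pi / (n + 1 : ℕ)) p) p.1
      rw [Real.dist_eq, dist_eq_norm] at h
      have h' := norm_circlePoint_sub_le (Real.pi / (n + 1 : ℕ)) p
      rw [abs_of_pos (a := Real.pi / (n + 1 : ℕ)) (by positivity)] at h'
      have hn : ((n + 1 : ℕ) : ℝ) ≠ 0 := by positivity
      gcongr ?_ ^ 2
      calc |((n + 1 : ℕ) : ℝ)| * |φ (circlePoint (Real.pi / (n + 1 : ℕ)) p) - φ p.1|
          ≤ ((n + 1 : ℕ) : ℝ) * (K * (Real.pi / (n + 1 : ℕ) * (‖p.1‖ + ‖p.2‖))) := by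
            rw [Nat.abs_cast]; gcongr; exact h.trans (by gcongr)
        _ = Real.pi * K * (‖p.1‖ + ‖p.2‖) := by field_simp
    · filter_upwards [hdiff] with p hp
      refine Filter.Tendsto.pow ?_ 2
      have hcurve : HasDerivAt (fun θ : ℝ => circlePoint θ p) p.2 0 := by
        have h1 := ((Real.hasDerivAt_cos 0).smul_const p.1).add
          ((Real.hasDerivAt_sin 0).smul_const p.2)
        simp only [Real.sin_zero, Real.cos_zero, neg_zero, zero_smul, one_smul, zero_add] at h1
        exact h1
      have hφ0 : HasFDerivAt φ (fderiv ℝ φ p.1) (circlePoint 0 p) := by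
        have : circlePoint 0 p = p.1 := by simp [circlePoint]
        rw [this]; exact hp.hasFDerivAt
      have hcomp : HasDerivAt (fun θ : ℝ => φ (circlePoint θ p)) (fderiv ℝ φ p.1 p.2) 0 :=
        hφ0.comp_hasDerivAt 0 hcurve
      have hs := hcomp.tendsto_slope
      have hseq : Filter.Tendsto (fun n : ℕ => Real.pi / (n + 1 : ℕ)) Filter.atTop (𝓝[≠] 0) := by
        refine tendsto_nhdsWithin_iff.2 ⟨?_, Filter.Eventually.of_forall fun n => ?_⟩
        · have := (tendsto_const_div_atTop_nhds_zero_nat Real.pi).comp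
            (Filter.tendsto_add_atTop_nat 1)
          exact this
        · have : Real.pi / ((n + 1 : ℕ) : ℝ) ≠ 0 := by positivity
          simpa using this
      have h2 := ((hs.comp hseq).const_mul Real.pi)
      refine h2.congr fun n => ?_
      have hn : ((n + 1 : ℕ) : ℝ) ≠ 0 := by positivity
      have h0 : circlePoint 0 p = p.1 := by simp [circlePoint]
      simp only [Function.comp_apply, slope_def_field, h0, sub_zero]
      field_simp
  have hmain : ∫ x, (φ x - φ (-x)) ^ 2 ∂(stdGaussian V) ≤
      ∫ p, (Real.pi * fderiv ℝ φ p.1 p.2) ^ 2 ∂Γ :=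
    ge_of_tendsto hlim (Filter.Eventually.of_forall fun n =>
      integral_sq_sub_neg_le_step hφ (n + 1) (Nat.succ_ne_zero n))
  refine hmain.trans ?_
  have hmeas : Measurable (fun p : V × V => (Real.pi * fderiv ℝ φ p.1 p.2) ^ 2) := by
    have h1 : Measurable (fun p : V × V => fderiv ℝ φ p.1) :=
      (measurable_fderiv ℝ φ).comp measurable_fst
    have h2 : Measurable (fun p : V × V => fderiv ℝ φ p.1 p.2) := by
      have hb : Continuous (fun q : (V →L[ℝ] ℝ) × V => q.1 q.2) := by fun_prop
      exact hb.measurable.comp (h1.prodMk measurable_snd)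
    exact (h2.const_mul _).pow_const 2
  have hnorm : ∀ x, ‖fderiv ℝ φ x‖ ≤ K := fun x => norm_fderiv_le_of_lipschitz ℝ hφ
  have hint : Integrable (fun p : V × V => (Real.pi * fderiv ℝ φ p.1 p.2) ^ 2) Γ := by
    refine (integrable_sq_norm_add_prod_stdGaussian.const_mul ((Real.pi * K) ^ 2)).mono'
      hmeas.aestronglyMeasurable (ae_of_all _ fun p => ?_)
    rw [Real.norm_of_nonneg (sq_nonneg _), ← mul_pow, ← sq_abs, abs_mul,
      abs_of_pos Real.pi_pos, mul_assoc]
    have h1 := (fderiv ℝ φ p.1).le_of_opNorm_le (hnorm p.1) p.2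
    rw [Real.norm_eq_abs] at h1
    gcongr
    refine h1.trans ?_
    gcongr
    exact le_add_of_nonneg_left (norm_nonneg _)
  rw [integral_prod _ hint]
  calc ∫ x, ∫ y, (Real.pi * fderiv ℝ φ x y) ^ 2 ∂(stdGaussian V) ∂(stdGaussian V)
      = ∫ x, Real.pi ^ 2 * ‖fderiv ℝ φ x‖ ^ 2 ∂(stdGaussian V) := by
        refine integral_congr_ae (ae_of_all _ fun x => ?_)
        simp only [mul_pow]
        rw [integral_const_mul, integral_sq_dual_stdGaussian]
    _ ≤ ∫ _, Real.pi ^ 2 * (K : ℝ) ^ 2 ∂(stdGaussian V) := by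
        refine integral_mono_of_nonneg (ae_of_all _ fun x => by positivity)
          (integrable_const _) (ae_of_all _ fun x => ?_)
        have := hnorm x
        dsimp only
        gcongr
    _ = _ := by simp

end Gaussian

/-! ### The uniform distribution on the sphere -/

section Sphere

variable {d : ℕ}

theorem integral_uniformSphere (g : E d → ℝ) :
    ∫ u, g u ∂(uniformSphere d) =
      ((volume : Measure (E d)).toSphere Set.univ)⁻¹.toReal *
        ∫ u, g u ∂((volume : Measure (E d)).toSphere) := by
  rw [uniformSphere,
    (MeasurableEmbedding.subtype_coe Metric.isClosed_sphere.measurableSet).integral_map,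
    integral_smul_measure, smul_eq_mul]

/-- Polar coordinates: the direction of a standard Gaussian vector is uniform, and independent of
its norm. -/
theorem integral_norm_sq_mul_direction (hd : 1 ≤ d) (g : E d → ℝ) :
    ∫ x, ‖x‖ ^ 2 * g (‖x‖⁻¹ • x) ∂(stdGaussian (E d)) = d * ∫ u, g u ∂(uniformSphere d) := by
  have := isProbabilityMeasure_uniformSphere d hd
  have : Nonempty (Fin d) := ⟨⟨0, hd⟩⟩
  have : Nontrivial (E d) := inferInstance
  have hm : Measurable (fun x : E d => gaussianDensity (E d) ‖x‖) :=
    measurable_gaussianDensity.comp measurable_norm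
  set S := (volume : Measure (E d)).toSphere
  have hS0 : S Set.univ ≠ 0 := by
    rw [Ne, Measure.measure_univ_eq_zero]; exact Measure.toSphere_ne_zero _
  obtain ⟨c, hc⟩ : ∃ c : ℝ, ∀ g : E d → ℝ,
      ∫ x, ‖x‖ ^ 2 * g (‖x‖⁻¹ • x) ∂(stdGaussian (E d)) = c * ∫ u, g u ∂(uniformSphere d) := by
    refine ⟨(S Set.univ).toReal * ∫ r : Set.Ioi (0 : ℝ), gaussianDensity (E d) r * (r : ℝ) ^ 2
      ∂(Measure.volumeIoiPow (Module.finrank ℝ (E d) - 1)), fun g => ?_⟩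
    rw [stdGaussian_eq_withDensity, integral_withDensity_eq_integral_smul hm,
      integral_uniformSphere]
    calc ∫ x : E d, gaussianDensity (E d) ‖x‖ • (‖x‖ ^ 2 * g (‖x‖⁻¹ • x))
        = ∫ x : ({(0)}ᶜ : Set (E d)), gaussianDensity (E d) ‖x.1‖ •
            (‖x.1‖ ^ 2 * g (‖x.1‖⁻¹ • x.1)) ∂((volume : Measure (E d)).comap (↑)) := by
          rw [integral_subtype_comap (measurableSet_singleton _).compl
            fun x : E d => gaussianDensity (E d) ‖x‖ • (‖x‖ ^ 2 * g (‖x‖⁻¹ • x)),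
            restrict_compl_singleton]
      _ = ∫ q, (fun u : Metric.sphere (0 : E d) 1 => g u) q.1 *
            (fun r : Set.Ioi (0 : ℝ) => gaussianDensity (E d) r * (r : ℝ) ^ 2) q.2
            ∂S.prod (.volumeIoiPow (Module.finrank ℝ (E d) - 1)) := by
          rw [← (volume : Measure (E d)).measurePreserving_homeomorphUnitSphereProd.integral_comp
            (Homeomorph.measurableEmbedding _)]
          refine integral_congr_ae (ae_of_all _ fun x => ?_)
          simp only [homeomorphUnitSphereProd_apply_fst_coe,
            homeomorphUnitSphereProd_apply_snd_coe, NNReal.smul_def, smul_eq_mul]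
          ring
      _ = (∫ u : Metric.sphere (0 : E d) 1, g u ∂S) *
            ∫ r : Set.Ioi (0 : ℝ), gaussianDensity (E d) r * (r : ℝ) ^ 2
              ∂(Measure.volumeIoiPow (Module.finrank ℝ (E d) - 1)) :=
          integral_prod_mul (L := ℝ) (fun u : Metric.sphere (0 : E d) 1 => g u)
            (fun r : Set.Ioi (0 : ℝ) => gaussianDensity (E d) r * (r : ℝ) ^ 2)
      _ = _ := by
          have : (S Set.univ).toReal ≠ 0 := ENNReal.toReal_ne_zero.2 ⟨hS0, measure_ne_top _ _⟩
          rw [show (volume : Measure (E d)).toSphere = S from rfl, ENNReal.toReal_inv]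
          field_simp
  -- the constant is the second moment of the norm
  have h1 := hc fun _ => 1
  simp only [mul_one, integral_norm_sq_stdGaussian, integral_const, probReal_univ, smul_eq_mul,
    finrank_euclideanSpace_fin] at h1
  rw [hc, ← h1]

theorem ae_norm_eq_one : ∀ᵐ u ∂(uniformSphere d), ‖u‖ = 1 := by
  rw [uniformSphere, ae_map_iff measurable_subtype_coe.aemeasurable
    (measurableSet_eq_fun measurable_norm measurable_const)]
  exact ae_of_all _ fun u => by simp

theorem map_neg_uniformSphere (hd : 1 ≤ d) :
    (uniformSphere d).map (fun u => -u) = uniformSphere d := by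
  have := isProbabilityMeasure_uniformSphere d hd
  have hinv : ∀ g : E d → ℝ, ∫ u, g (-u) ∂(uniformSphere d) = ∫ u, g u ∂(uniformSphere d) := by
    intro g
    have hd' : (d : ℝ) ≠ 0 := by positivity
    have h : ∫ x, ‖x‖ ^ 2 * g (-(‖x‖⁻¹ • x)) ∂(stdGaussian (E d)) =
        ∫ x, ‖x‖ ^ 2 * g (‖x‖⁻¹ • x) ∂(stdGaussian (E d)) := by
      have hmp : MeasurePreserving (fun x : E d => -x) (stdGaussian (E d)) (stdGaussian (E d)) :=
        ⟨measurable_neg, map_neg_stdGaussian⟩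
      rw [← hmp.integral_comp (MeasurableEquiv.neg (E d)).measurableEmbedding
        fun x => ‖x‖ ^ 2 * g (‖x‖⁻¹ • x)]
      simp
    rw [integral_norm_sq_mul_direction hd fun u => g (-u),
      integral_norm_sq_mul_direction hd g] at h
    exact mul_left_cancel₀ hd' h
  have hp := Measure.isProbabilityMeasure_map (μ := uniformSphere d) (f := fun u => -u)
    measurable_neg.aemeasurable
  refine Measure.ext fun s hs => ?_
  rw [Measure.map_apply measurable_neg hs]
  have h := hinv (s.indicator 1)
  have h2 : ∀ u : E d, s.indicator (1 : E d → ℝ) (-u) =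
      ((fun u => -u) ⁻¹' s).indicator (1 : E d → ℝ) u := fun u => rfl
  simp_rw [h2] at h
  rw [integral_indicator_one hs, integral_indicator_one (measurable_neg hs)] at h
  exact (measureReal_eq_measureReal_iff).1 h

theorem integral_inner_sq_uniformSphere (hd : 1 ≤ d) (a : E d) :
    ∫ u, ⟪a, u⟫ ^ 2 ∂(uniformSphere d) = ‖a‖ ^ 2 / d := by
  have hd' : (d : ℝ) ≠ 0 := by positivity
  rw [eq_div_iff hd', mul_comm, ← integral_norm_sq_mul_direction hd,
    ← integral_inner_sq_stdGaussian]
  refine integral_congr_ae (ae_of_all _ fun x => ?_)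
  rcases eq_or_ne x 0 with rfl | hx
  · simp
  · have : ‖x‖ ≠ 0 := norm_ne_zero_iff.2 hx
    simp only [real_inner_smul_right]
    field_simp

/-- Extending an odd Lipschitz function on the sphere to a positively homogeneous function of degree
one on the whole space keeps it Lipschitz. -/
theorem lipschitzWith_homogeneous_extension {V : Type*} [NormedAddCommGroup V]
    [InnerProductSpace ℝ V] {ψ : V → ℝ} {K : ℝ} (hK : 0 ≤ K)
    (hψ : ∀ u v, ‖u‖ = 1 → ‖v‖ = 1 → |ψ u - ψ v| ≤ K * ‖u - v‖)
    (hodd : ∀ u, ψ (-u) = -ψ u) :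
    LipschitzWith (3 * K).toNNReal fun x => ‖x‖ * ψ (‖x‖⁻¹ • x) := by
  have hb : ∀ u, ‖u‖ = 1 → |ψ u| ≤ K := by
    intro u hu
    have h := hψ u (-u) hu (by rwa [norm_neg])
    rw [hodd, sub_neg_eq_add, sub_neg_eq_add, ← two_mul, abs_mul, abs_two, ← two_smul ℝ u,
      norm_smul, hu] at h
    norm_num at h
    linarith
  have hunit : ∀ x : V, x ≠ 0 → ‖‖x‖⁻¹ • x‖ = 1 := fun x hx => by
    rw [norm_smul, norm_inv, norm_norm, inv_mul_cancel₀ (norm_ne_zero_iff.2 hx)]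
  have hsm : ∀ x : V, x ≠ 0 → ‖x‖ • (‖x‖⁻¹ • x) = x := fun x hx => by
    rw [smul_smul, mul_inv_cancel₀ (norm_ne_zero_iff.2 hx), one_smul]
  refine LipschitzWith.of_dist_le_mul fun x y => ?_
  rw [Real.dist_eq, dist_eq_norm, Real.coe_toNNReal _ (by positivity)]
  rcases eq_or_ne x 0 with rfl | hx
  · rcases eq_or_ne y 0 with rfl | hy
    · simp
    · rw [norm_zero, zero_mul, zero_sub, abs_neg, abs_mul, abs_norm, zero_sub, norm_neg]
      have := hb _ (hunit y hy)
      nlinarith [norm_nonneg y]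
  rcases eq_or_ne y 0 with rfl | hy
  · rw [norm_zero, zero_mul, sub_zero, abs_mul, abs_norm, sub_zero]
    have := hb _ (hunit x hx)
    nlinarith [norm_nonneg x]
  set x' := ‖x‖⁻¹ • x
  set y' := ‖y‖⁻¹ • y
  have h1 : ‖x‖ * ψ x' - ‖y‖ * ψ y' = ‖x‖ * (ψ x' - ψ y') + (‖x‖ - ‖y‖) * ψ y' := by ring
  have h2 : ‖x‖ * ‖x' - y'‖ ≤ 2 * ‖x - y‖ := by
    have : ‖x‖ * ‖x' - y'‖ = ‖(x - y) + (‖y‖ - ‖x‖) • y'‖ := by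
      rw [← norm_norm x, ← norm_smul, norm_norm, smul_sub, hsm x hx, sub_smul, hsm y hy]
      congr 1; abel
    rw [this]
    refine (norm_add_le _ _).trans ?_
    rw [norm_smul, hunit y hy, Real.norm_eq_abs, mul_one, two_mul]
    gcongr
    rw [norm_sub_rev x y]
    exact abs_norm_sub_norm_le y x
  have h3 : |‖x‖ * (ψ x' - ψ y')| ≤ 2 * K * ‖x - y‖ := by
    rw [abs_mul, abs_norm]
    calc ‖x‖ * |ψ x' - ψ y'| ≤ ‖x‖ * (K * ‖x' - y'‖) := by
          gcongr; exact hψ _ _ (hunit x hx) (hunit y hy)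
      _ = K * (‖x‖ * ‖x' - y'‖) := by ring
      _ ≤ K * (2 * ‖x - y‖) := by gcongr
      _ = _ := by ring
  have h4 : |(‖x‖ - ‖y‖) * ψ y'| ≤ K * ‖x - y‖ := by
    rw [abs_mul, mul_comm]
    exact mul_le_mul (hb _ (hunit y hy)) (abs_norm_sub_norm_le x y) (abs_nonneg _) hK
  rw [h1]
  refine (abs_add_le _ _).trans ?_
  linarith

/-- Concentration on the sphere: the antipodal increments of a Lipschitz function are of order
`1 / √d` in mean square. -/
theorem integral_sq_antipodal_le (hd : 1 ≤ d) {φ : E d → ℝ} {K : ℝ} (hK : 0 ≤ K)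
    (hφ : ∀ u v, ‖u‖ = 1 → ‖v‖ = 1 → |φ u - φ v| ≤ K * ‖u - v‖) :
    ∫ u, (φ u - φ (-u)) ^ 2 ∂(uniformSphere d) ≤ 90 * K ^ 2 / d := by
  have hd' : (0 : ℝ) < d := by positivity
  set ψ : E d → ℝ := fun u => φ u - φ (-u) with hψ
  have hodd : ∀ u, ψ (-u) = -ψ u := fun u => by simp [hψ]
  have hlip : ∀ u v, ‖u‖ = 1 → ‖v‖ = 1 → |ψ u - ψ v| ≤ 2 * K * ‖u - v‖ := by
    intro u v hu hv
    have h1 := hφ u v hu hv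
    have h2 := hφ (-v) (-u) (by rwa [norm_neg]) (by rwa [norm_neg])
    rw [show -v - -u = u - v by abel] at h2
    calc |ψ u - ψ v| = |(φ u - φ v) + (φ (-v) - φ (-u))| := by simp only [hψ]; ring_nf
      _ ≤ _ := (abs_add_le _ _).trans (by linarith)
  have hext := lipschitzWith_homogeneous_extension (by positivity) hlip hodd
  have h := integral_sq_sub_neg_le_of_lipschitz hext
  rw [Real.coe_toNNReal _ (by positivity)] at h
  have heq : ∫ x, (‖x‖ * ψ (‖x‖⁻¹ • x) - ‖-x‖ * ψ (‖-x‖⁻¹ • -x)) ^ 2 ∂(stdGaussian (E d)) =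
      4 * (d * ∫ u, ψ u ^ 2 ∂(uniformSphere d)) := by
    rw [← integral_norm_sq_mul_direction hd fun u => ψ u ^ 2, ← integral_const_mul]
    refine integral_congr_ae (ae_of_all _ fun x => ?_)
    simp only [norm_neg, smul_neg, hodd]
    ring
  rw [heq] at h
  have hpi : Real.pi ^ 2 ≤ 10 := by
    have := Real.pi_lt_d2
    nlinarith [Real.pi_pos]
  rw [le_div_iff₀ hd']
  nlinarith [sq_nonneg K]

/-- By the Cauchy–Schwarz inequality, concentration bounds the correlation of antipodal increments
with a linear function by order `1 / d`. -/
theorem integral_antipodal_mul_inner_le (hd : 1 ≤ d) {φ : E d → ℝ} {K : ℝ} (hK : 0 < K)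
    (hφm : Continuous φ)
    (hφ : ∀ u v, ‖u‖ = 1 → ‖v‖ = 1 → |φ u - φ v| ≤ K * ‖u - v‖) (a : E d) :
    |∫ u, (φ u - φ (-u)) * ⟪a, u⟫ ∂(uniformSphere d)| ≤ 10 * K * ‖a‖ / d := by
  have := isProbabilityMeasure_uniformSphere d hd
  have hd' : (0 : ℝ) < d := by positivity
  rcases eq_or_ne a 0 with rfl | ha
  · simp
  have ha' : 0 < ‖a‖ := norm_pos_iff.2 ha
  have hA := integral_sq_antipodal_le hd hK.le hφ
  have hB := integral_inner_sq_uniformSphere hd a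
  have hc1 : Continuous fun u : E d => (φ u - φ (-u)) := hφm.sub (hφm.comp continuous_neg)
  have hc2 : Continuous fun u : E d => ⟪a, u⟫ := by fun_prop
  have hi1 : Integrable (fun u => (φ u - φ (-u)) ^ 2) (uniformSphere d) := by
    refine Integrable.of_bound (hc1.pow 2).aestronglyMeasurable ((2 * K) ^ 2) ?_
    filter_upwards [ae_norm_eq_one] with u hu
    have h := hφ u (-u) hu (by rwa [norm_neg])
    rw [sub_neg_eq_add, ← two_smul ℝ u, norm_smul, hu] at h
    rw [Real.norm_of_nonneg (sq_nonneg _), ← sq_abs]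
    gcongr
    refine h.trans (le_of_eq ?_)
    norm_num
    ring
  have hi2 : Integrable (fun u => ⟪a, u⟫ ^ 2) (uniformSphere d) := by
    refine Integrable.of_bound (hc2.pow 2).aestronglyMeasurable (‖a‖ ^ 2) ?_
    filter_upwards [ae_norm_eq_one] with u hu
    rw [Real.norm_of_nonneg (sq_nonneg _), ← sq_abs]
    gcongr
    simpa [hu] using abs_real_inner_le_norm a u
  -- the weight that balances the two terms of the inequality of means
  set w : ℝ := ‖a‖ / (10 * K) with hw
  have hwpos : 0 < w := by positivity
  have hpt : ∀ u : E d, |(φ u - φ (-u)) * ⟪a, u⟫| ≤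
      w / 2 * (φ u - φ (-u)) ^ 2 + 1 / (2 * w) * ⟪a, u⟫ ^ 2 := by
    intro u
    rw [abs_mul, ← sq_abs (φ u - φ (-u)), ← sq_abs ⟪a, u⟫]
    set s := |φ u - φ (-u)|
    set t := |⟪a, u⟫|
    have : w / 2 * s ^ 2 + 1 / (2 * w) * t ^ 2 - s * t = (w * s - t) ^ 2 / (2 * w) := by
      field_simp; ring
    have h2 : 0 ≤ (w * s - t) ^ 2 / (2 * w) := by positivity
    linarith
  calc |∫ u, (φ u - φ (-u)) * ⟪a, u⟫ ∂(uniformSphere d)|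
      ≤ ∫ u, |(φ u - φ (-u)) * ⟪a, u⟫| ∂(uniformSphere d) := abs_integral_le_integral_abs
    _ ≤ ∫ u, (w / 2 * (φ u - φ (-u)) ^ 2 + 1 / (2 * w) * ⟪a, u⟫ ^ 2) ∂(uniformSphere d) :=
        integral_mono_of_nonneg (ae_of_all _ fun u => abs_nonneg _)
          ((hi1.const_mul _).add (hi2.const_mul _)) (ae_of_all _ hpt)
    _ = w / 2 * ∫ u, (φ u - φ (-u)) ^ 2 ∂(uniformSphere d) + 1 / (2 * w) * (‖a‖ ^ 2 / d) := by
        rw [integral_add (hi1.const_mul _) (hi2.const_mul _), integral_const_mul,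
          integral_const_mul, hB]
    _ ≤ w / 2 * (90 * K ^ 2 / d) + 1 / (2 * w) * (‖a‖ ^ 2 / d) := by gcongr
    _ = 9.5 * K * ‖a‖ / d := by rw [hw]; field_simp; norm_num
    _ ≤ _ := by gcongr; norm_num

end Sphere

/-! ### Smooth functions and the two-point estimator -/

section Smooth

variable {d : ℕ} {M : ℝ} {f : E d → ℝ}

theorem IsSmooth.mono {M' : ℝ} (hf : IsSmooth M f) (h : M ≤ M') : IsSmooth M' f :=
  ⟨hf.1, fun x y => (hf.2 x y).trans (by gcongr)⟩

theorem IsSmooth.continuous_gradient (hf : IsSmooth M f) : Continuous (gradient f) := by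
  have h : LipschitzWith M.toNNReal (gradient f) := LipschitzWith.of_dist_le_mul fun x y => by
    rw [dist_eq_norm, dist_eq_norm]
    exact (hf.2 x y).trans (mul_le_mul_of_nonneg_right (Real.le_coe_toNNReal M) (norm_nonneg _))
  exact h.continuous

theorem norm_gradient_le {L : ℝ} (hL : 0 ≤ L) (hf : ∀ x y, |f x - f y| ≤ L * ‖x - y‖) (x : E d) :
    ‖gradient f x‖ ≤ L := by
  have h : LipschitzWith L.toNNReal f := LipschitzWith.of_dist_le_mul fun x y => by
    rw [Real.dist_eq, dist_eq_norm, Real.coe_toNNReal _ hL]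
    exact hf x y
  rw [gradient, LinearIsometryEquiv.norm_map]
  simpa [Real.coe_toNNReal _ hL] using norm_fderiv_le_of_lipschitz ℝ h (x₀ := x)

/-- On a convex set where the gradient stays within `c` of `∇f(x)`, the first-order remainder of `f`
at `x` is `c`-Lipschitz. -/
theorem IsSmooth.abs_remainder_le (hf : IsSmooth M f) {s : Set (E d)} (hs : Convex ℝ s) {x : E d}
    {c : ℝ} (hc : ∀ z ∈ s, M * ‖z - x‖ ≤ c) {y z : E d} (hy : y ∈ s) (hz : z ∈ s) :
    |f z - f y - ⟪gradient f x, z - y⟫| ≤ c * ‖z - y‖ := by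
  have h := hs.norm_image_sub_le_of_norm_hasFDerivWithin_le' (𝕜 := ℝ) (f := f)
    (f' := fun w => fderiv ℝ f w) (φ := fderiv ℝ f x) (C := c)
    (fun w _ => (hf.1 w).hasFDerivAt.hasFDerivWithinAt) (fun w hw => ?_) hy hz
  · rw [Real.norm_eq_abs] at h
    rwa [gradient, InnerProductSpace.toDual_symm_apply]
  · refine le_trans ?_ ((hf.2 w x).trans (hc w hw))
    rw [gradient, gradient, ← map_sub, LinearIsometryEquiv.norm_map]

theorem IsSmooth.le_add_inner_add (hf : IsSmooth M f) (hM : 0 ≤ M) (x v : E d) :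
    f (x - v) ≤ f x - ⟪gradient f x, v⟫ + M * ‖v‖ ^ 2 := by
  have h := hf.abs_remainder_le (convex_segment x (x - v)) (x := x) (c := M * ‖v‖) (fun z hz => ?_)
    (left_mem_segment ℝ _ _) (right_mem_segment ℝ _ _)
  · rw [show x - v - x = -v by abel, inner_neg_right, norm_neg] at h
    have := (abs_le.1 h).2
    linarith
  · gcongr
    have h2 := norm_sub_le_of_mem_segment hz
    rwa [show x - v - x = -v by abel, norm_neg] at h2

theorem IsSmooth.abs_sphere_remainder_le (hf : IsSmooth M f) (hM : 0 ≤ M) {δ : ℝ} (hδ : 0 ≤ δ)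
    (x : E d) {u v : E d} (hu : ‖u‖ = 1) (hv : ‖v‖ = 1) :
    |(f (x + δ • u) - δ * ⟪gradient f x, u⟫) - (f (x + δ • v) - δ * ⟪gradient f x, v⟫)| ≤
      M * δ ^ 2 * ‖u - v‖ := by
  have hmem : ∀ w : E d, ‖w‖ = 1 → x + δ • w ∈ Metric.closedBall x δ := fun w hw => by
    rw [Metric.mem_closedBall, dist_eq_norm, add_sub_cancel_left, norm_smul, hw, mul_one,
      Real.norm_of_nonneg hδ]
  have h := hf.abs_remainder_le (convex_closedBall x δ) (x := x) (c := M * δ) (fun z hz => ?_)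
    (hmem v hv) (hmem u hu)
  · rw [show x + δ • u - (x + δ • v) = δ • (u - v) by module, real_inner_smul_right,
      inner_sub_right, norm_smul, Real.norm_of_nonneg hδ] at h
    calc _ = |f (x + δ • u) - f (x + δ • v) -
          δ * (⟪gradient f x, u⟫ - ⟪gradient f x, v⟫)| := by ring_nf
      _ ≤ _ := h
      _ = _ := by ring
  · rw [Metric.mem_closedBall, dist_eq_norm] at hz
    gcongr

/-- The mean of the two-point estimator is correlated with the gradient, up to a bias of order
`M δ` that does not grow with the dimension. -/
theorem IsSmooth.twoPoint_bias (hd : 1 ≤ d) (hf : IsSmooth M f) (hM : 0 < M) {δ : ℝ} (hδ : 0 < δ)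
    (x : E d) :
    ‖gradient f x‖ ^ 2 - 5 * M * δ * ‖gradient f x‖ ≤
      ∫ u, ⟪gradient f x, twoPoint δ f x u⟫ ∂(uniformSphere d) := by
  have := isProbabilityMeasure_uniformSphere d hd
  have hd' : (0 : ℝ) < d := by positivity
  set a := gradient f x
  set φ : E d → ℝ := fun u => f (x + δ • u) - δ * ⟪a, u⟫ with hφ
  have hφc : Continuous φ := by
    have := hf.1.continuous
    fun_prop
  have hmain := integral_antipodal_mul_inner_le hd (K := M * δ ^ 2) (by positivity) hφc
    (fun u v hu hv => hf.abs_sphere_remainder_le hM.le hδ.le x hu hv) a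
  have hi1 : Integrable (fun u => ⟪a, u⟫ ^ 2) (uniformSphere d) := by
    refine Integrable.of_bound (by fun_prop) (‖a‖ ^ 2) ?_
    filter_upwards [ae_norm_eq_one] with u hu
    rw [Real.norm_of_nonneg (sq_nonneg _), ← sq_abs]
    gcongr
    simpa [hu] using abs_real_inner_le_norm a u
  have hi2 : Integrable (fun u => (φ u - φ (-u)) * ⟪a, u⟫) (uniformSphere d) := by
    refine Integrable.of_bound (by fun_prop) (M * δ ^ 2 * 2 * ‖a‖) ?_
    filter_upwards [ae_norm_eq_one] with u hu
    rw [Real.norm_eq_abs, abs_mul]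
    have h := hf.abs_sphere_remainder_le hM.le hδ.le x hu (v := -u) (by rwa [norm_neg])
    rw [sub_neg_eq_add, ← two_smul ℝ u, norm_smul, hu, Real.norm_ofNat,
      mul_one] at h
    gcongr
    simpa [hu] using abs_real_inner_le_norm a u
  have hpt : ∀ u, ⟪a, twoPoint δ f x u⟫ =
      d * ⟪a, u⟫ ^ 2 + d / (2 * δ) * ((φ u - φ (-u)) * ⟪a, u⟫) := by
    intro u
    simp only [twoPoint, hφ, real_inner_smul_right, inner_neg_right, smul_neg, ← sub_eq_add_neg]
    field_simp
    ring
  simp_rw [hpt]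
  rw [integral_add (hi1.const_mul _) (hi2.const_mul _), integral_const_mul, integral_const_mul,
    integral_inner_sq_uniformSphere hd]
  have h1 := (abs_le.1 hmain).1
  have h2 : d / (2 * δ) * (-(10 * (M * δ ^ 2) * ‖a‖ / d)) ≤
      d / (2 * δ) * ∫ u, (φ u - φ (-u)) * ⟪a, u⟫ ∂(uniformSphere d) := by gcongr
  have h3 : (d : ℝ) * (‖a‖ ^ 2 / d) = ‖a‖ ^ 2 := by field_simp
  have h4 : d / (2 * δ) * (-(10 * (M * δ ^ 2) * ‖a‖ / d)) = -(5 * M * δ * ‖a‖) := by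
    field_simp; ring
  linarith

end Smooth

section TwoPoint

variable {d : ℕ} {φ : E d → ℝ} {L δ : ℝ}

theorem norm_twoPoint_le (hφ : ∀ x y, |φ x - φ y| ≤ L * ‖x - y‖) (hδ : 0 < δ) (x : E d)
    {u : E d} (hu : ‖u‖ = 1) : ‖twoPoint δ φ x u‖ ≤ d * L := by
  have h := hφ (x + δ • u) (x - δ • u)
  rw [show x + δ • u - (x - δ • u) = (2 * δ) • u by module, norm_smul, hu, mul_one,
    Real.norm_of_nonneg (by positivity)] at h
  rw [twoPoint, norm_smul, hu, mul_one, norm_mul, Real.norm_of_nonneg (by positivity),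
    Real.norm_eq_abs]
  calc d / (2 * δ) * |φ (x + δ • u) - φ (x - δ • u)| ≤ d / (2 * δ) * (L * (2 * δ)) := by gcongr
    _ = d * L := by field_simp

theorem integral_norm_sq_twoPoint_le (hd : 1 ≤ d) (hL : 0 ≤ L)
    (hφ : ∀ x y, |φ x - φ y| ≤ L * ‖x - y‖) (hδ : 0 < δ) (x : E d) :
    ∫ u, ‖twoPoint δ φ x u‖ ^ 2 ∂(uniformSphere d) ≤ 23 * (d * L ^ 2) := by
  have hd' : (0 : ℝ) < d := by positivity
  have h := integral_sq_antipodal_le hd (φ := fun u => φ (x + δ • u)) (K := L * δ) (by positivity)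
    (fun u v _ _ => by
      have h := hφ (x + δ • u) (x + δ • v)
      rw [show x + δ • u - (x + δ • v) = δ • (u - v) by module, norm_smul,
        Real.norm_of_nonneg hδ.le] at h
      linarith)
  have heq : ∫ u, ‖twoPoint δ φ x u‖ ^ 2 ∂(uniformSphere d) = (d / (2 * δ)) ^ 2 *
      ∫ u, (φ (x + δ • u) - φ (x + δ • -u)) ^ 2 ∂(uniformSphere d) := by
    rw [← integral_const_mul]
    refine integral_congr_ae ?_
    filter_upwards [ae_norm_eq_one] with u hu
    rw [twoPoint, norm_smul, hu, mul_one, Real.norm_eq_abs, sq_abs, mul_pow, smul_neg,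
      ← sub_eq_add_neg]
  rw [heq]
  calc _ ≤ (d / (2 * δ)) ^ 2 * (90 * (L * δ) ^ 2 / d) := by gcongr
    _ = 22.5 * (d * L ^ 2) := by field_simp; ring
    _ ≤ _ := by gcongr; norm_num

end TwoPoint

/-! ### One step of the algorithm -/

/-- What a step of the algorithm needs from the past: the iterate `x_t`, the previous query point
`w_{t-1}` and the value that was observed there. -/
abbrev State (d : ℕ) : Type := E d × E d × ℝ

section OneStep

variable {d : ℕ} {Ξ : Type*} (W : ℝ × ℝ × E d × E d → ℝ≥0∞) (F : E d → Ξ → ℝ) (η δ D : ℝ)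

/-- The lazy query is used in state `s` for the direction `p.1` and the sample `p.2`. Here
`W (α, β, x, y)` is the temporal variation between the present value `α` at `x` and the previous
value `β` at `y`. -/
def IsLazy (s : State d) (p : E d × Ξ) : Prop :=
  W (F (s.1 + δ • p.1) p.2, s.2.2, s.1 + δ • p.1, s.2.1) ≤ ENNReal.ofReal D

/-- The one-point estimator in state `s`. -/
def lazyEst (s : State d) (p : E d × Ξ) : E d :=
  onePoint δ (fun x => F x p.2) s.2.2 s.1 p.1

/-- The two-point estimator in state `s`. -/
def fullEst (s : State d) (p : E d × Ξ) : E d :=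
  twoPoint δ (fun x => F x p.2) s.1 p.1

open Classical in
/-- The estimator that is used in state `s`. -/
def gradEst (s : State d) (p : E d × Ξ) : E d :=
  if IsLazy W F δ D s p then lazyEst F δ s p else fullEst F δ s p

/-- The transition from one state to the next. -/
def step (s : State d) (p : E d × Ξ) : State d :=
  (s.1 - η • gradEst W F δ D s p, s.1 + δ • p.1, F (s.1 + δ • p.1) p.2)

variable {W F η δ D}

section Measurability

variable [MeasurableSpace Ξ]

theorem measurable_query (hF : Measurable (Function.uncurry F)) {c : ℝ} :
    Measurable fun q : State d × E d × Ξ => F (q.1.1 + c • q.2.1) q.2.2 := by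
  have : Measurable fun q : State d × E d × Ξ => (q.1.1 + c • q.2.1, q.2.2) := by fun_prop
  exact hF.comp this

theorem measurableSet_isLazy (hW : Measurable W) (hF : Measurable (Function.uncurry F)) :
    MeasurableSet {q : State d × E d × Ξ | IsLazy W F δ D q.1 q.2} := by
  have h : Measurable fun q : State d × E d × Ξ =>
      (F (q.1.1 + δ • q.2.1) q.2.2, q.1.2.2, q.1.1 + δ • q.2.1, q.1.2.1) :=
    (measurable_query hF).prodMk (by fun_prop)
  exact measurableSet_le (hW.comp h) measurable_const

theorem measurable_lazyEst (hF : Measurable (Function.uncurry F)) :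
    Measurable fun q : State d × E d × Ξ => lazyEst F δ q.1 q.2 := by
  have h := measurable_query hF (c := δ)
  unfold lazyEst onePoint
  fun_prop

theorem measurable_fullEst (hF : Measurable (Function.uncurry F)) :
    Measurable fun q : State d × E d × Ξ => fullEst F δ q.1 q.2 := by
  have h := measurable_query hF (c := δ)
  have h2 := measurable_query hF (c := -δ)
  simp only [neg_smul, ← sub_eq_add_neg] at h2
  unfold fullEst twoPoint
  fun_prop

theorem measurable_gradEst (hW : Measurable W) (hF : Measurable (Function.uncurry F)) :
    Measurable fun q : State d × E d × Ξ => gradEst W F δ D q.1 q.2 := by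
  classical
  unfold gradEst
  exact Measurable.ite (measurableSet_isLazy hW hF) (measurable_lazyEst hF) (measurable_fullEst hF)

theorem measurable_step (hW : Measurable W) (hF : Measurable (Function.uncurry F)) :
    Measurable fun q : State d × E d × Ξ => step W F η δ D q.1 q.2 := by
  have h1 := measurable_query hF (c := δ)
  have h2 := measurable_gradEst (δ := δ) (D := D) hW hF
  unfold step
  fun_prop

end Measurability

variable [MeasurableSpace Ξ] {ν : Measure Ξ} {L M : ℝ}

/-- Almost surely the direction is a unit vector and the sampled loss is Lipschitz. -/
theorem ae_prod_norm_eq_one_and_lipschitz [SFinite ν] (hd : 1 ≤ d)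
    (hlip : ∀ᵐ z ∂ν, ∀ x y, |F x z - F y z| ≤ L * ‖x - y‖) :
    ∀ᵐ p ∂((uniformSphere d).prod ν),
      ‖p.1‖ = 1 ∧ ∀ x y, |F x p.2 - F y p.2| ≤ L * ‖x - y‖ := by
  have := isProbabilityMeasure_uniformSphere d hd
  filter_upwards [Measure.quasiMeasurePreserving_fst.ae (ae_norm_eq_one (d := d)),
    Measure.quasiMeasurePreserving_snd.ae hlip] with p h1 h2 using ⟨h1, h2⟩

variable [IsProbabilityMeasure ν] {ρ : Measure (State d)} [IsProbabilityMeasure ρ]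

theorem abs_objective_sub_le (hi : ∀ x, Integrable (F x) ν)
    (hlip : ∀ᵐ z ∂ν, ∀ x y, |F x z - F y z| ≤ L * ‖x - y‖) (x y : E d) :
    |objective ν F x - objective ν F y| ≤ L * ‖x - y‖ := by
  rw [objective, objective, ← integral_sub (hi x) (hi y), ← Real.norm_eq_abs]
  have h := norm_integral_le_of_norm_le_const (μ := ν) (f := fun z => F x z - F y z)
    (C := L * ‖x - y‖) (by filter_upwards [hlip] with z hz using hz x y)
  simpa using h

theorem integral_norm_sq_fullEst_le (hd : 1 ≤ d) (hL : 0 ≤ L) (hδ : 0 < δ)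
    (hF : Measurable (Function.uncurry F))
    (hlip : ∀ᵐ z ∂ν, ∀ x y, |F x z - F y z| ≤ L * ‖x - y‖) :
    Integrable (fun q : State d × E d × Ξ => ‖fullEst F δ q.1 q.2‖ ^ 2)
        (ρ.prod ((uniformSphere d).prod ν)) ∧
      ∫ q, ‖fullEst F δ q.1 q.2‖ ^ 2 ∂(ρ.prod ((uniformSphere d).prod ν)) ≤
        23 * (d * L ^ 2) := by
  have := isProbabilityMeasure_uniformSphere d hd
  have hint : Integrable (fun q : State d × E d × Ξ => ‖fullEst F δ q.1 q.2‖ ^ 2)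
      (ρ.prod ((uniformSphere d).prod ν)) := by
    refine Integrable.of_bound ((measurable_fullEst hF).norm.pow_const 2).aestronglyMeasurable
      ((d * L) ^ 2) ?_
    filter_upwards [Measure.quasiMeasurePreserving_snd.ae
      (ae_prod_norm_eq_one_and_lipschitz hd hlip)] with q hq
    rw [Real.norm_of_nonneg (sq_nonneg _)]
    gcongr
    exact norm_twoPoint_le hq.2 hδ _ hq.1
  refine ⟨hint, ?_⟩
  rw [integral_prod _ hint]
  have hinner : ∀ᵐ s ∂ρ, ∫ p, ‖fullEst F δ s p‖ ^ 2 ∂((uniformSphere d).prod ν) ≤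
      23 * (d * L ^ 2) := by
    filter_upwards [hint.prod_right_ae] with s hs
    rw [integral_prod_symm _ hs]
    calc ∫ z, ∫ u, ‖fullEst F δ s (u, z)‖ ^ 2 ∂(uniformSphere d) ∂ν
        ≤ ∫ _, 23 * (d * L ^ 2) ∂ν := by
          refine integral_mono_of_nonneg
            (ae_of_all _ fun z => integral_nonneg fun u => sq_nonneg _) (integrable_const _) ?_
          filter_upwards [hlip] with z hz
          exact integral_norm_sq_twoPoint_le hd hL hz hδ s.1
      _ = _ := by simp
  calc _ ≤ ∫ _, 23 * (d * L ^ 2) ∂ρ :=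
        integral_mono_of_nonneg (ae_of_all _ fun s => integral_nonneg fun p => sq_nonneg _)
          (integrable_const _) hinner
    _ = _ := by simp

theorem le_integral_inner_fullEst (hd : 1 ≤ d) (hL : 0 ≤ L) (hδ : 0 < δ) (hM : 0 < M)
    (hF : Measurable (Function.uncurry F)) (hi : ∀ x, Integrable (F x) ν)
    (hlip : ∀ᵐ z ∂ν, ∀ x y, |F x z - F y z| ≤ L * ‖x - y‖) (hf : IsSmooth M (objective ν F)) :
    Integrable (fun q : State d × E d × Ξ =>
        ⟪gradient (objective ν F) q.1.1, fullEst F δ q.1 q.2⟫)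
        (ρ.prod ((uniformSphere d).prod ν)) ∧
      ∫ s, (‖gradient (objective ν F) s.1‖ ^ 2 -
          5 * M * δ * ‖gradient (objective ν F) s.1‖) ∂ρ ≤
        ∫ q, ⟪gradient (objective ν F) q.1.1, fullEst F δ q.1 q.2⟫
          ∂(ρ.prod ((uniformSphere d).prod ν)) := by
  have := isProbabilityMeasure_uniformSphere d hd
  have hgc : Measurable (gradient (objective ν F)) := hf.continuous_gradient.measurable
  have hgb := norm_gradient_le hL (abs_objective_sub_le hi hlip)
  have hint : Integrable (fun q : State d × E d × Ξ =>
      ⟪gradient (objective ν F) q.1.1, fullEst F δ q.1 q.2⟫)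
      (ρ.prod ((uniformSphere d).prod ν)) := by
    have hm := measurable_fullEst (δ := δ) hF
    refine Integrable.of_bound
      (Measurable.inner (hgc.comp (by fun_prop)) hm).aestronglyMeasurable (L * (d * L)) ?_
    filter_upwards [Measure.quasiMeasurePreserving_snd.ae
      (ae_prod_norm_eq_one_and_lipschitz hd hlip)] with q hq
    refine (norm_inner_le_norm _ _).trans ?_
    gcongr
    · exact hgb _
    · exact norm_twoPoint_le hq.2 hδ _ hq.1
  refine ⟨hint, ?_⟩
  rw [integral_prod _ hint]
  refine integral_mono_ae ?_ hint.integral_prod_left ?_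
  · have hm : Measurable fun s : State d => gradient (objective ν F) s.1 := hgc.comp measurable_fst
    refine Integrable.of_bound
      ((hm.norm.pow_const 2).sub (hm.norm.const_mul _)).aestronglyMeasurable
      (L ^ 2 + 5 * M * δ * L) (ae_of_all _ fun s => ?_)
    refine (norm_sub_le _ _).trans ?_
    rw [Real.norm_of_nonneg (by positivity), Real.norm_of_nonneg (by positivity)]
    gcongr <;> exact hgb _
  · filter_upwards [hint.prod_right_ae] with s hs
    rw [integral_prod _ hs]
    refine (hf.twoPoint_bias hd hM hδ s.1).trans (le_of_eq ?_)
    refine integral_congr_ae (ae_of_all _ fun u => ?_)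
    simp only [fullEst, twoPoint, real_inner_smul_right, objective]
    rw [integral_mul_const, integral_const_mul, integral_sub (hi _) (hi _)]

/-- On the symmetric part of the lazy set the one-point estimator has the same mean as the two-point
estimator: their difference there is an odd function of the direction. -/
theorem integral_symmetric_part_eq_zero (hd : 1 ≤ d) (a : State d → E d)
    (h : State d × E d × Ξ → ℝ) (hh : h = open Classical in fun q =>
      if IsLazy W F δ D q.1 q.2 ∧ IsLazy W F δ D q.1 (-q.2.1, q.2.2) then
        ⟪a q.1, lazyEst F δ q.1 q.2 - fullEst F δ q.1 q.2⟫ else 0) :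
    ∫ q, h q ∂(ρ.prod ((uniformSphere d).prod ν)) = 0 := by
  have := isProbabilityMeasure_uniformSphere d hd
  set e : State d × E d × Ξ ≃ᵐ State d × E d × Ξ :=
    (MeasurableEquiv.refl _).prodCongr ((MeasurableEquiv.neg (E d)).prodCongr
      (MeasurableEquiv.refl _))
  have he : ∀ q, e q = (q.1, -q.2.1, q.2.2) := fun q => rfl
  have hmp : MeasurePreserving e (ρ.prod ((uniformSphere d).prod ν))
      (ρ.prod ((uniformSphere d).prod ν)) := by
    have hneg : MeasurePreserving (fun u : E d => -u) (uniformSphere d) (uniformSphere d) :=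
      ⟨measurable_neg, map_neg_uniformSphere hd⟩
    exact (MeasurePreserving.id ρ).prod (hneg.prod (MeasurePreserving.id ν))
  have hodd : ∀ q, h (e q) = -h q := by
    intro q
    classical
    simp only [hh, he, neg_neg, Prod.mk.eta]
    by_cases h1 : IsLazy W F δ D q.1 q.2 <;>
      by_cases h2 : IsLazy W F δ D q.1 (-q.2.1, q.2.2) <;> simp only [h1, h2, and_self,
        and_false, false_and, if_true, if_false, neg_zero]
    rw [← inner_neg_right]
    congr 1
    simp only [lazyEst, fullEst, onePoint, twoPoint, smul_neg, ← sub_eq_add_neg, sub_neg_eq_add]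
    rw [show (d : ℝ) / (2 * δ) = d / δ / 2 by ring]
    module
  have h1 := hmp.integral_comp e.measurableEmbedding h
  simp_rw [hodd] at h1
  rw [integral_neg] at h1
  linarith

/-- The mean of the estimator is correlated with the gradient, up to the bias of the two-point
estimator and the probability of the asymmetric part of the lazy set. -/
theorem le_integral_inner_gradEst (hd : 1 ≤ d) (hL : 0 ≤ L) (hδ : 0 < δ) (hM : 0 < M)
    (hW : Measurable W) (hF : Measurable (Function.uncurry F)) (hi : ∀ x, Integrable (F x) ν)
    (hlip : ∀ᵐ z ∂ν, ∀ x y, |F x z - F y z| ≤ L * ‖x - y‖) (hf : IsSmooth M (objective ν F))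
    {B : ℝ} (hB : 0 ≤ B)
    (hlazy : ∀ᵐ q ∂(ρ.prod ((uniformSphere d).prod ν)), IsLazy W F δ D q.1 q.2 →
      ‖lazyEst F δ q.1 q.2‖ ≤ B) :
    ∫ s, (‖gradient (objective ν F) s.1‖ ^ 2 -
          5 * M * δ * ‖gradient (objective ν F) s.1‖) ∂ρ -
        L * (B + d * L) * (ρ.prod ((uniformSphere d).prod ν)).real
          {q | IsLazy W F δ D q.1 q.2 ∧ ¬ IsLazy W F δ D q.1 (-q.2.1, q.2.2)} ≤
      ∫ q, ⟪gradient (objective ν F) q.1.1, gradEst W F δ D q.1 q.2⟫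
        ∂(ρ.prod ((uniformSphere d).prod ν)) := by
  classical
  have := isProbabilityMeasure_uniformSphere d hd
  set Q := ρ.prod ((uniformSphere d).prod ν)
  have hgc : Measurable (gradient (objective ν F)) := hf.continuous_gradient.measurable
  have hgb := norm_gradient_le hL (abs_objective_sub_le hi hlip)
  obtain ⟨hint, hfull⟩ := le_integral_inner_fullEst (ρ := ρ) hd hL hδ hM hF hi hlip hf
  set a : State d → E d := fun s => gradient (objective ν F) s.1
  have ham : Measurable fun q : State d × E d × Ξ => a q.1 := hgc.comp (by fun_prop)
  have hlm := measurable_lazyEst (δ := δ) hF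
  have hfm := measurable_fullEst (δ := δ) hF
  have hgm := measurable_gradEst (δ := δ) (D := D) hW hF
  have hA := measurableSet_isLazy (δ := δ) (D := D) hW hF
  have hneg : Measurable fun q : State d × E d × Ξ => (q.1, -q.2.1, q.2.2) := by fun_prop
  have hA' : MeasurableSet {q : State d × E d × Ξ | IsLazy W F δ D q.1 (-q.2.1, q.2.2)} :=
    hneg hA
  set N : Set (State d × E d × Ξ) :=
    {q | IsLazy W F δ D q.1 q.2 ∧ ¬ IsLazy W F δ D q.1 (-q.2.1, q.2.2)}
  have hN : MeasurableSet N := hA.inter hA'.compl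
  set h : State d × E d × Ξ → ℝ := fun q =>
      if IsLazy W F δ D q.1 q.2 ∧ IsLazy W F δ D q.1 (-q.2.1, q.2.2) then
        ⟪a q.1, lazyEst F δ q.1 q.2 - fullEst F δ q.1 q.2⟫ else 0 with hh
  have hzero : ∫ q, h q ∂Q = 0 := integral_symmetric_part_eq_zero hd a h (by rw [hh])
  have hbound : ∀ᵐ q ∂Q, ‖fullEst F δ q.1 q.2‖ ≤ d * L := by
    filter_upwards [Measure.quasiMeasurePreserving_snd.ae
      (ae_prod_norm_eq_one_and_lipschitz hd hlip)] with q hq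
    exact norm_twoPoint_le hq.2 hδ _ hq.1
  have hdiff : ∀ᵐ q ∂Q, IsLazy W F δ D q.1 q.2 →
      |⟪a q.1, lazyEst F δ q.1 q.2 - fullEst F δ q.1 q.2⟫| ≤ L * (B + d * L) := by
    filter_upwards [hbound, hlazy] with q h1 h2 h3
    refine (abs_real_inner_le_norm _ _).trans ?_
    gcongr
    · exact hgb _
    · exact (norm_sub_le _ _).trans (add_le_add (h2 h3) h1)
  have hhint : Integrable h Q := by
    refine Integrable.of_bound (Measurable.ite (hA.inter hA')
      (ham.inner (hlm.sub hfm)) measurable_const).aestronglyMeasurable (L * (B + d * L)) ?_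
    filter_upwards [hdiff] with q hq
    by_cases hs : IsLazy W F δ D q.1 q.2 ∧ IsLazy W F δ D q.1 (-q.2.1, q.2.2)
    · simp only [hh, hs, and_self, if_true]
      exact hq hs.1
    · simp only [hh, hs, if_false, norm_zero]
      positivity
  have hgint : Integrable (fun q => ⟪a q.1, gradEst W F δ D q.1 q.2⟫) Q := by
    refine Integrable.of_bound (ham.inner hgm).aestronglyMeasurable (L * (B + d * L)) ?_
    filter_upwards [hbound, hlazy] with q h1 h2
    refine (norm_inner_le_norm _ _).trans ?_
    gcongr
    · exact hgb _
    · rw [gradEst]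
      split_ifs with h3
      · exact (h2 h3).trans (le_add_of_nonneg_right (by positivity))
      · exact h1.trans (le_add_of_nonneg_left hB)
  have hNint : Integrable (N.indicator (fun _ => (1 : ℝ))) Q :=
    (integrable_const 1).indicator hN
  have hpt : ∀ᵐ q ∂Q, ⟪a q.1, fullEst F δ q.1 q.2⟫ + h q -
      L * (B + d * L) * N.indicator (fun _ => (1 : ℝ)) q ≤ ⟪a q.1, gradEst W F δ D q.1 q.2⟫ := by
    filter_upwards [hdiff] with q hq
    by_cases h1 : IsLazy W F δ D q.1 q.2
    · have hg : gradEst W F δ D q.1 q.2 = lazyEst F δ q.1 q.2 := by simp only [gradEst, h1, if_true]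
      have hq' := (abs_le.1 (hq h1)).1
      rw [inner_sub_right] at hq'
      by_cases h2 : IsLazy W F δ D q.1 (-q.2.1, q.2.2)
      · have hqN : q ∉ N := fun hc => hc.2 h2
        rw [hg, Set.indicator_of_notMem hqN]
        simp only [hh, h1, h2, and_self, if_true, inner_sub_right]
        linarith
      · have hqN : q ∈ N := ⟨h1, h2⟩
        rw [hg, Set.indicator_of_mem hqN]
        simp only [hh, h1, h2, and_false, if_false]
        linarith
    · have hqN : q ∉ N := fun hc => h1 hc.1
      rw [Set.indicator_of_notMem hqN]
      simp only [hh, gradEst, h1, false_and, if_false]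
      linarith
  have hsum : Integrable (fun q => ⟪a q.1, fullEst F δ q.1 q.2⟫ + h q) Q := hint.add hhint
  have hmono : ∫ q, (⟪a q.1, fullEst F δ q.1 q.2⟫ + h q -
      L * (B + d * L) * N.indicator (fun _ => (1 : ℝ)) q) ∂Q ≤
      ∫ q, ⟪a q.1, gradEst W F δ D q.1 q.2⟫ ∂Q :=
    integral_mono_ae (hsum.sub (hNint.const_mul (L * (B + d * L)))) hgint hpt
  rw [integral_sub hsum (hNint.const_mul _), integral_add hint hhint, hzero,
      integral_const_mul, integral_indicator_const _ hN, add_zero, smul_eq_mul, mul_one] at hmono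
  linarith

end OneStep

/-! ### Runs of the algorithm -/

/-- A process that is driven by independent inputs is independent of the next input. -/
theorem indepFun_of_recursion {Ω S Y : Type*} [MeasurableSpace Ω] [MeasurableSpace S]
    [MeasurableSpace Y] {P : Measure Ω} {p : ℕ → Ω → Y} (hp : ∀ t, Measurable (p t))
    (hind : iIndepFun p P) {X : ℕ → Ω → S} {s₀ : S} (h0 : ∀ ω, X 0 ω = s₀)
    {Φ : ℕ → S × Y → S} (hΦ : ∀ t, Measurable (Φ t))
    (hX : ∀ t ω, X (t + 1) ω = Φ t (X t ω, p t ω)) (t : ℕ) :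
    IndepFun (X t) (p t) P := by
  set past : ℕ → MeasurableSpace Ω :=
    fun t => ⨆ i ∈ Set.Iio t, MeasurableSpace.comap (p i) inferInstance with hpast
  have hmono : ∀ t, past t ≤ past (t + 1) := fun t =>
    biSup_mono fun i (hi : i < t) => show i < t + 1 by omega
  have hlast : ∀ t, MeasurableSpace.comap (p t) inferInstance ≤ past (t + 1) := fun t =>
    le_biSup (fun i => MeasurableSpace.comap (p i) inferInstance) (show t ∈ Set.Iio (t + 1) by simp)
  have hadapt : ∀ t, Measurable[past t] (X t) := by
    intro t
    induction t with
    | zero =>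
      have : X 0 = fun _ => s₀ := funext h0
      rw [this]
      exact measurable_const
    | succ t ih =>
      have : X (t + 1) = fun ω => Φ t (X t ω, p t ω) := funext (hX t)
      rw [this]
      have h1 : Measurable[past (t + 1)] (X t) := ih.mono (hmono t) le_rfl
      have h2 : Measurable[past (t + 1)] (p t) := (comap_measurable (p t)).mono (hlast t) le_rfl
      exact (hΦ t).comp (h1.prodMk h2)
  have hindep := indep_iSup_of_disjoint (fun i => (hp i).comap_le) hind
    (S := Set.Iio t) (T := {t}) (by simp)
  rw [IndepFun_iff_Indep]
  refine indep_of_indep_of_le_left (indep_of_indep_of_le_right hindep ?_) (hadapt t).comap_le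
  simp

section Run

variable {d : ℕ} {Ξ : Type*}

/-- The temporal variation at time `t`: at time `0` it is infinite, because no lazy query is
possible. -/
def timeVariation (W : ℝ × ℝ × E d × E d → ℝ≥0∞) : ℕ → ℝ × ℝ × E d × E d → ℝ≥0∞
  | 0 => fun _ => ⊤
  | _ + 1 => W

/-- The states of a run. The previous query of the initial state is a dummy, which is never used. -/
def runState (W : ℝ × ℝ × E d × E d → ℝ≥0∞) (F : E d → Ξ → ℝ) (η δ D : ℝ) (x₀ : E d)
    (u : ℕ → E d) (ξ : ℕ → Ξ) : ℕ → State d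
  | 0 => (x₀, 0, 0)
  | t + 1 => step (timeVariation W t) F η δ D (runState W F η δ D x₀ u ξ t) (u t, ξ t)

variable {W : ℝ × ℝ × E d × E d → ℝ≥0∞} {V : Variation d} {F : E d → Ξ → ℝ} {η δ D : ℝ} {x₀ : E d}
  {u : ℕ → E d} {ξ : ℕ → Ξ}

theorem not_isLazy_zero (s : State d) (p : E d × Ξ) :
    ¬ IsLazy (timeVariation W 0) F δ D s p := by
  simp [IsLazy, timeVariation]

theorem runState_fst (hV : ∀ f g x y, V f g x y = W (f x, g y, x, y)) (t : ℕ) :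
    (runState W F η δ D x₀ u ξ t).1 = iterates V F η δ D x₀ u ξ t := by
  induction t using Nat.twoStepInduction with
  | zero => rfl
  | one =>
    simp only [runState, step, gradEst, not_isLazy_zero, if_false, iterates, fullEst]
  | more t h1 h2 =>
    rw [iterates, ← h2, ← h1, runState, step, gradEst, estimator]
    have hiff : IsLazy (timeVariation W (t + 1)) F δ D (runState W F η δ D x₀ u ξ (t + 1))
        (u (t + 1), ξ (t + 1)) ↔ u (t + 1) ∈ lazySet V δ D (fun x => F x (ξ (t + 1)))
          (fun x => F x (ξ t)) (runState W F η δ D x₀ u ξ (t + 1)).1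
          (runState W F η δ D x₀ u ξ t).1 (u t) := by
      simp only [lazySet, Set.mem_ofPred_eq, hV]
      rfl
    by_cases hm : u (t + 1) ∈ lazySet V δ D (fun x => F x (ξ (t + 1)))
          (fun x => F x (ξ t)) (runState W F η δ D x₀ u ξ (t + 1)).1
          (runState W F η δ D x₀ u ξ t).1 (u t)
    · rw [if_pos hm, if_pos (hiff.2 hm)]
      rfl
    · rw [if_neg hm, if_neg (mt hiff.1 hm)]
      rfl

theorem isLazy_runState_iff (hV : ∀ f g x y, V f g x y = W (f x, g y, x, y)) (t : ℕ) (v : E d) :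
    IsLazy (timeVariation W (t + 1)) F δ D (runState W F η δ D x₀ u ξ (t + 1)) (v, ξ (t + 1)) ↔
      v ∈ runLazySet V F η δ D x₀ u ξ t := by
  simp only [runLazySet, lazySet, Set.mem_ofPred_eq, hV, ← runState_fst hV]
  rfl

/-- The estimator at time `t` of a run. -/
def runEst (W : ℝ × ℝ × E d × E d → ℝ≥0∞) (F : E d → Ξ → ℝ) (η δ D : ℝ) (x₀ : E d)
    (u : ℕ → E d) (ξ : ℕ → Ξ) (t : ℕ) : E d :=
  gradEst (timeVariation W t) F δ D (runState W F η δ D x₀ u ξ t) (u t, ξ t)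

/-- Quantitative control of the lazy queries: if the temporal variation `W` is at most `D`, then the
lazy estimator is bounded in terms of the distance of the two query points. The constants are
arranged so that the norm of the lazy estimator is at most `a` times that of the previous estimator
plus `β`. -/
structure LazyControl (d : ℕ) (W : ℝ × ℝ × E d × E d → ℝ≥0∞) (η δ D a β : ℝ) : Prop where
  eta_pos : 0 < η
  delta_pos : 0 < δ
  nonneg : 0 ≤ a
  sq_le : 10 * a ^ 2 ≤ 1
  bound : ∀ r s x y, W (r, s, x, y) ≤ ENNReal.ofReal D →
    d / δ * |r - s| ≤ a / η * ‖x - y‖ + (β - 2 * a * δ / η)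

variable {L a β B : ℝ}

theorem LazyControl.norm_lazyEst_le (hc : LazyControl d W η δ D a β) (hu : ∀ t, ‖u t‖ = 1) (t : ℕ)
    (hlazy : IsLazy (timeVariation W (t + 1)) F δ D (runState W F η δ D x₀ u ξ (t + 1))
      (u (t + 1), ξ (t + 1))) :
    ‖lazyEst F δ (runState W F η δ D x₀ u ξ (t + 1)) (u (t + 1), ξ (t + 1))‖ ≤
      a * ‖runEst W F η δ D x₀ u ξ t‖ + β := by
  have hη := hc.eta_pos
  have hδ := hc.delta_pos
  have ha := hc.nonneg
  have h := hc.bound _ _ _ _ hlazy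
  set s := runState W F η δ D x₀ u ξ t with hs
  set g := runEst W F η δ D x₀ u ξ t with hg
  have h1 : runState W F η δ D x₀ u ξ (t + 1) =
    (s.1 - η • g, s.1 + δ • u t, F (s.1 + δ • u t) (ξ t)) := rfl
  have hdist : ‖(runState W F η δ D x₀ u ξ (t + 1)).1 + δ • u (t + 1) -
      (runState W F η δ D x₀ u ξ (t + 1)).2.1‖ ≤ η * ‖g‖ + 2 * δ := by
    rw [h1]
    dsimp only
    rw [show s.1 - η • g + δ • u (t + 1) - (s.1 + δ • u t) =
      -(η • g) + δ • u (t + 1) - δ • u t by abel]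
    refine (norm_sub_le _ _).trans ?_
    refine (add_le_add_left (norm_add_le _ _) _).trans (le_of_eq ?_)
    rw [norm_neg, norm_smul, norm_smul, norm_smul, hu, hu, Real.norm_of_nonneg hη.le,
      Real.norm_of_nonneg hδ.le]
    ring
  have hnorm : ‖lazyEst F δ (runState W F η δ D x₀ u ξ (t + 1)) (u (t + 1), ξ (t + 1))‖ =
      d / δ * |F ((runState W F η δ D x₀ u ξ (t + 1)).1 + δ • u (t + 1)) (ξ (t + 1)) -
        (runState W F η δ D x₀ u ξ (t + 1)).2.2| := by
    rw [lazyEst, onePoint, norm_smul, hu, mul_one, norm_mul, Real.norm_of_nonneg (by positivity),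
      Real.norm_eq_abs]
  rw [hnorm]
  refine h.trans ?_
  calc _ ≤ a / η * (η * ‖g‖ + 2 * δ) + (β - 2 * a * δ / η) := by gcongr
    _ = a * ‖g‖ + β := by field_simp; ring

theorem LazyControl.norm_runEst_le (hc : LazyControl d W η δ D a β) (hu : ∀ t, ‖u t‖ = 1)
    (hξ : ∀ t x y, |F x (ξ t) - F y (ξ t)| ≤ L * ‖x - y‖) (hdB : d * L ≤ B) (hB : a * B + β ≤ B)
    (t : ℕ) : ‖runEst W F η δ D x₀ u ξ t‖ ≤ B := by
  have ha := hc.nonneg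
  induction t with
  | zero =>
    rw [runEst, gradEst, if_neg (not_isLazy_zero _ _)]
    exact (norm_twoPoint_le (hξ 0) hc.delta_pos _ (hu 0)).trans hdB
  | succ t ih =>
    rw [runEst, gradEst]
    split_ifs with h
    · refine (hc.norm_lazyEst_le hu t h).trans (le_trans ?_ hB)
      gcongr
    · exact (norm_twoPoint_le (hξ _) hc.delta_pos _ (hu _)).trans hdB

theorem LazyControl.norm_lazyEst_le_of_isLazy (hc : LazyControl d W η δ D a β)
    (hu : ∀ t, ‖u t‖ = 1) (hξ : ∀ t x y, |F x (ξ t) - F y (ξ t)| ≤ L * ‖x - y‖) (hdB : d * L ≤ B)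
    (hB : a * B + β ≤ B) (t : ℕ)
    (hlazy : IsLazy (timeVariation W t) F δ D (runState W F η δ D x₀ u ξ t) (u t, ξ t)) :
    ‖lazyEst F δ (runState W F η δ D x₀ u ξ t) (u t, ξ t)‖ ≤ B := by
  have h := hc.norm_runEst_le (x₀ := x₀) hu hξ hdB hB t
  rwa [runEst, gradEst, if_pos hlazy] at h

theorem norm_sq_runEst_zero :
    ‖runEst W F η δ D x₀ u ξ 0‖ ^ 2 =
      ‖fullEst F δ (runState W F η δ D x₀ u ξ 0) (u 0, ξ 0)‖ ^ 2 := by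
  rw [runEst, gradEst, if_neg (not_isLazy_zero _ _)]

theorem LazyControl.norm_sq_runEst_succ_le (hc : LazyControl d W η δ D a β)
    (hu : ∀ t, ‖u t‖ = 1) (t : ℕ) :
    ‖runEst W F η δ D x₀ u ξ (t + 1)‖ ^ 2 ≤
      ‖fullEst F δ (runState W F η δ D x₀ u ξ (t + 1)) (u (t + 1), ξ (t + 1))‖ ^ 2 +
        (1 / 5 * ‖runEst W F η δ D x₀ u ξ t‖ ^ 2 + 2 * β ^ 2) := by
  set r := ‖runEst W F η δ D x₀ u ξ t‖ with hr
  have ha := hc.sq_le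
  rw [runEst, gradEst]
  split_ifs with h
  · have h1 := hc.norm_lazyEst_le hu t h
    rw [← hr] at h1
    have h2 : (a * r + β) ^ 2 ≤ 1 / 5 * r ^ 2 + 2 * β ^ 2 := by
      nlinarith [sq_nonneg (a * r - β), mul_nonneg (sub_nonneg.2 ha) (sq_nonneg r)]
    refine le_add_of_nonneg_of_le (sq_nonneg _) (le_trans ?_ h2)
    gcongr
  · exact le_add_of_nonneg_right (by positivity)

end Run

/-! ### Expectations along a run -/

section Expectation

variable {d : ℕ} {Ω Ξ : Type*} [MeasurableSpace Ω] {P : Measure Ω}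
  {W : ℝ × ℝ × E d × E d → ℝ≥0∞} {F : E d → Ξ → ℝ} {η δ D : ℝ} {x₀ : E d}
  {u : ℕ → Ω → E d} {ξ : ℕ → Ω → Ξ} {L M a β B : ℝ}

variable (P W F η δ D x₀ u ξ) in
/-- The probability that the direction at time `t` lies in the lazy set, but its antipode does
not. -/
def asymmetry (t : ℕ) : ℝ :=
  P.real {ω | IsLazy (timeVariation W t) F δ D
      (runState W F η δ D x₀ (fun s => u s ω) (fun s => ξ s ω) t) (u t ω, ξ t ω) ∧
    ¬ IsLazy (timeVariation W t) F δ D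
      (runState W F η δ D x₀ (fun s => u s ω) (fun s => ξ s ω) t) (-u t ω, ξ t ω)}

theorem sum_asymmetry {V : Variation d} (hV : ∀ f g x y, V f g x y = W (f x, g y, x, y)) (T : ℕ) :
    ∑ t ∈ Finset.range (T + 1), asymmetry P W F η δ D x₀ u ξ t =
      totalAsymmetry P V F η δ D x₀ u ξ T := by
  rw [Finset.sum_range_succ', totalAsymmetry]
  have h0 : asymmetry P W F η δ D x₀ u ξ 0 = 0 := by
    simp [asymmetry, not_isLazy_zero]
  rw [h0, add_zero]
  refine Finset.sum_congr rfl fun t _ => ?_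
  rw [asymmetry]
  congr 1
  ext ω
  simp only [Set.mem_ofPred_eq, Set.mem_sdiff, mem_symmPart_iff]
  rw [isLazy_runState_iff (u := fun s => u s ω) (ξ := fun s => ξ s ω) hV t,
    isLazy_runState_iff (u := fun s => u s ω) (ξ := fun s => ξ s ω) hV t]
  tauto

variable [MeasurableSpace Ξ] {ν : Measure Ξ}

theorem measurable_timeVariation (hW : Measurable W) (t : ℕ) : Measurable (timeVariation W t) := by
  cases t with
  | zero => exact measurable_const
  | succ t => exact hW

theorem measurable_runState (hs : IsSampling P ν u ξ) (hW : Measurable W)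
    (hF : Measurable (Function.uncurry F)) (t : ℕ) :
    Measurable fun ω => runState W F η δ D x₀ (fun s => u s ω) (fun s => ξ s ω) t := by
  induction t with
  | zero => exact measurable_const
  | succ t ih =>
    exact (measurable_step (measurable_timeVariation hW t) hF).comp
      (ih.prodMk ((hs.measurable_u t).prodMk (hs.measurable_ξ t)))

theorem measurable_runEst (hs : IsSampling P ν u ξ) (hW : Measurable W)
    (hF : Measurable (Function.uncurry F)) (t : ℕ) :
    Measurable fun ω => runEst W F η δ D x₀ (fun s => u s ω) (fun s => ξ s ω) t :=
  (measurable_gradEst (measurable_timeVariation hW t) hF).comp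
    ((measurable_runState hs hW hF t).prodMk ((hs.measurable_u t).prodMk (hs.measurable_ξ t)))

/-- The state and the present inputs are independent. -/
theorem map_runState_prod [IsProbabilityMeasure P] (hs : IsSampling P ν u ξ) (hW : Measurable W)
    (hF : Measurable (Function.uncurry F)) (t : ℕ) :
    P.map (fun ω => (runState W F η δ D x₀ (fun s => u s ω) (fun s => ξ s ω) t, u t ω, ξ t ω)) =
      (P.map fun ω => runState W F η δ D x₀ (fun s => u s ω) (fun s => ξ s ω) t).prod
        ((uniformSphere d).prod ν) := by
  have hp : ∀ t, Measurable fun ω => (u t ω, ξ t ω) := fun t =>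
    (hs.measurable_u t).prodMk (hs.measurable_ξ t)
  have hind := indepFun_of_recursion hp hs.indep
    (X := fun t ω => runState W F η δ D x₀ (fun s => u s ω) (fun s => ξ s ω) t) (s₀ := (x₀, 0, 0))
    (fun _ => rfl) (Φ := fun t q => step (timeVariation W t) F η δ D q.1 q.2)
    (fun t => measurable_step (measurable_timeVariation hW t) hF) (fun t ω => rfl) t
  rw [indepFun_iff_map_prod_eq_prod_map_map (measurable_runState hs hW hF t).aemeasurable
    (hp t).aemeasurable, hs.law t] at hind
  exact hind

variable [IsProbabilityMeasure ν]

theorem ae_norm_eq_one_and_lipschitz (hd : 1 ≤ d) (hs : IsSampling P ν u ξ)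
    (hlip : ∀ᵐ z ∂ν, ∀ x y, |F x z - F y z| ≤ L * ‖x - y‖) :
    ∀ᵐ ω ∂P, (∀ t, ‖u t ω‖ = 1) ∧ ∀ t x y, |F x (ξ t ω) - F y (ξ t ω)| ≤ L * ‖x - y‖ := by
  have h : ∀ t, ∀ᵐ ω ∂P, ‖u t ω‖ = 1 ∧ ∀ x y, |F x (ξ t ω) - F y (ξ t ω)| ≤ L * ‖x - y‖ := by
    intro t
    have h1 := ae_prod_norm_eq_one_and_lipschitz hd hlip
    rw [← hs.law t] at h1
    exact ae_of_ae_map ((hs.measurable_u t).prodMk (hs.measurable_ξ t)).aemeasurable h1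
  filter_upwards [ae_all_iff.2 h] with ω hω using ⟨fun t => (hω t).1, fun t => (hω t).2⟩

variable [IsProbabilityMeasure P]

theorem integral_norm_sq_runEst_le (hd : 1 ≤ d) (hL : 0 ≤ L) (hs : IsSampling P ν u ξ)
    (hW : Measurable W) (hF : Measurable (Function.uncurry F))
    (hlip : ∀ᵐ z ∂ν, ∀ x y, |F x z - F y z| ≤ L * ‖x - y‖) (hc : LazyControl d W η δ D a β)
    (hdB : d * L ≤ B) (hB : a * B + β ≤ B) (t : ℕ) :
    Integrable (fun ω => ‖runEst W F η δ D x₀ (fun s => u s ω) (fun s => ξ s ω) t‖ ^ 2) P ∧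
      ∫ ω, ‖runEst W F η δ D x₀ (fun s => u s ω) (fun s => ξ s ω) t‖ ^ 2 ∂P ≤
        5 / 4 * (23 * (d * L ^ 2) + 2 * β ^ 2) := by
  have hint : ∀ t, Integrable
      (fun ω => ‖runEst W F η δ D x₀ (fun s => u s ω) (fun s => ξ s ω) t‖ ^ 2) P := by
    intro t
    refine Integrable.of_bound
      ((measurable_runEst hs hW hF t).norm.pow_const 2).aestronglyMeasurable (B ^ 2) ?_
    filter_upwards [ae_norm_eq_one_and_lipschitz hd hs hlip] with ω hω
    rw [Real.norm_of_nonneg (sq_nonneg _)]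
    gcongr
    exact hc.norm_runEst_le hω.1 hω.2 hdB hB t
  have hfull : ∀ t, Integrable (fun ω => ‖fullEst F δ
        (runState W F η δ D x₀ (fun s => u s ω) (fun s => ξ s ω) t) (u t ω, ξ t ω)‖ ^ 2) P ∧
      ∫ ω, ‖fullEst F δ (runState W F η δ D x₀ (fun s => u s ω) (fun s => ξ s ω) t)
        (u t ω, ξ t ω)‖ ^ 2 ∂P ≤ 23 * (d * L ^ 2) := by
    intro t
    have hX := measurable_runState (η := η) (δ := δ) (D := D) (x₀ := x₀) hs hW hF t
    have hXp := hX.prodMk ((hs.measurable_u t).prodMk (hs.measurable_ξ t))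
    have := Measure.isProbabilityMeasure_map (μ := P) hX.aemeasurable
    obtain ⟨h1, h2⟩ := integral_norm_sq_fullEst_le
      (ρ := P.map fun ω => runState W F η δ D x₀ (fun s => u s ω) (fun s => ξ s ω) t)
      hd hL hc.delta_pos hF hlip
    rw [← map_runState_prod hs hW hF t] at h1 h2
    rw [integral_map hXp.aemeasurable h1.aestronglyMeasurable] at h2
    exact ⟨h1.comp_measurable hXp, h2⟩
  refine ⟨hint t, ?_⟩
  induction t with
  | zero =>
    simp_rw [norm_sq_runEst_zero]
    refine (hfull 0).2.trans ?_
    have : 0 ≤ (d : ℝ) * L ^ 2 := by positivity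
    nlinarith [sq_nonneg β]
  | succ t ih =>
    have hprev : Integrable (fun ω => 1 / 5 *
        ‖runEst W F η δ D x₀ (fun s => u s ω) (fun s => ξ s ω) t‖ ^ 2 + 2 * β ^ 2) P :=
      ((hint t).const_mul (1 / 5)).add (integrable_const _)
    have hle : ∫ ω, ‖runEst W F η δ D x₀ (fun s => u s ω) (fun s => ξ s ω) (t + 1)‖ ^ 2 ∂P ≤
        ∫ ω, (‖fullEst F δ (runState W F η δ D x₀ (fun s => u s ω) (fun s => ξ s ω) (t + 1))
          (u (t + 1) ω, ξ (t + 1) ω)‖ ^ 2 + (1 / 5 *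
          ‖runEst W F η δ D x₀ (fun s => u s ω) (fun s => ξ s ω) t‖ ^ 2 + 2 * β ^ 2)) ∂P := by
      refine integral_mono_ae (hint (t + 1)) ((hfull (t + 1)).1.add hprev) ?_
      filter_upwards [ae_norm_eq_one_and_lipschitz hd hs hlip] with ω hω
      exact hc.norm_sq_runEst_succ_le hω.1 t
    rw [integral_add (hfull (t + 1)).1 hprev,
      integral_add ((hint t).const_mul (1 / 5)) (integrable_const _), integral_const_mul,
      integral_const, probReal_univ, one_smul] at hle
    have := (hfull (t + 1)).2
    linarith

theorem le_integral_inner_runEst (hd : 1 ≤ d) (hL : 0 ≤ L) (hM : 0 < M) (hs : IsSampling P ν u ξ)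
    (hW : Measurable W) (hF : Measurable (Function.uncurry F)) (hi : ∀ x, Integrable (F x) ν)
    (hlip : ∀ᵐ z ∂ν, ∀ x y, |F x z - F y z| ≤ L * ‖x - y‖) (hf : IsSmooth M (objective ν F))
    (hc : LazyControl d W η δ D a β) (hdB : d * L ≤ B) (hB : a * B + β ≤ B) (t : ℕ) :
    1 / 2 * ∫ ω, ‖gradient (objective ν F)
          (runState W F η δ D x₀ (fun s => u s ω) (fun s => ξ s ω) t).1‖ ^ 2 ∂P -
        13 * M ^ 2 * δ ^ 2 - L * (B + d * L) * asymmetry P W F η δ D x₀ u ξ t ≤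
      ∫ ω, ⟪gradient (objective ν F)
          (runState W F η δ D x₀ (fun s => u s ω) (fun s => ξ s ω) t).1,
        runEst W F η δ D x₀ (fun s => u s ω) (fun s => ξ s ω) t⟫ ∂P := by
  have hδ := hc.delta_pos
  have hWt := measurable_timeVariation hW t
  have hX := measurable_runState (η := η) (δ := δ) (D := D) (x₀ := x₀) hs hW hF t
  have hXp := hX.prodMk ((hs.measurable_u t).prodMk (hs.measurable_ξ t))
  have hmapX := Measure.isProbabilityMeasure_map (μ := P) hX.aemeasurable
  have hgc : Measurable (gradient (objective ν F)) := hf.continuous_gradient.measurable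
  have hgb := norm_gradient_le hL (abs_objective_sub_le hi hlip)
  have hA := measurableSet_isLazy (δ := δ) (D := D) hWt hF
  have hneg : Measurable fun q : State d × E d × Ξ => (q.1, -q.2.1, q.2.2) := by fun_prop
  have hA' : MeasurableSet
      {q : State d × E d × Ξ | IsLazy (timeVariation W t) F δ D q.1 (-q.2.1, q.2.2)} := hneg hA
  have hNm : MeasurableSet {q : State d × E d × Ξ | IsLazy (timeVariation W t) F δ D q.1 q.2 ∧
      ¬ IsLazy (timeVariation W t) F δ D q.1 (-q.2.1, q.2.2)} := hA.inter hA'.compl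
  have hlaw := map_runState_prod (η := η) (δ := δ) (D := D) (x₀ := x₀) hs hW hF t
  set X : Ω → State d := fun ω => runState W F η δ D x₀ (fun s => u s ω) (fun s => ξ s ω) t
  have hBnn : 0 ≤ B := le_trans (by positivity) hdB
  have hlazy : ∀ᵐ q ∂((P.map X).prod ((uniformSphere d).prod ν)),
      IsLazy (timeVariation W t) F δ D q.1 q.2 → ‖lazyEst F δ q.1 q.2‖ ≤ B := by
    rw [← hlaw, ae_map_iff hXp.aemeasurable]
    · filter_upwards [ae_norm_eq_one_and_lipschitz hd hs hlip] with ω hω h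
      exact hc.norm_lazyEst_le_of_isLazy hω.1 hω.2 hdB hB t h
    · have : {q : State d × E d × Ξ | IsLazy (timeVariation W t) F δ D q.1 q.2 →
          ‖lazyEst F δ q.1 q.2‖ ≤ B} =
          {q : State d × E d × Ξ | IsLazy (timeVariation W t) F δ D q.1 q.2}ᶜ ∪
            {q | ‖lazyEst F δ q.1 q.2‖ ≤ B} := by
        ext q; simp [imp_iff_not_or]
      rw [this]
      exact hA.compl.union (measurableSet_le (measurable_lazyEst hF).norm measurable_const)
  have hmain := le_integral_inner_gradEst (ρ := P.map X) hd hL hδ hM hWt hF hi hlip hf hBnn hlazy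
  have hgradm : Measurable fun s : State d => gradient (objective ν F) s.1 :=
    hgc.comp measurable_fst
  have hdevm : Measurable fun s : State d => ‖gradient (objective ν F) s.1‖ ^ 2 -
      5 * M * δ * ‖gradient (objective ν F) s.1‖ :=
    (hgradm.norm.pow_const 2).sub (hgradm.norm.const_mul _)
  have hgradm' : Measurable fun q : State d × E d × Ξ => gradient (objective ν F) q.1.1 :=
    hgradm.comp measurable_fst
  rw [← hlaw, integral_map hXp.aemeasurable
      (hgradm'.inner (measurable_gradEst hWt hF)).aestronglyMeasurable,
    integral_map hX.aemeasurable hdevm.aestronglyMeasurable,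
    map_measureReal_apply hXp hNm] at hmain
  refine le_trans ?_ hmain
  rw [asymmetry]
  refine sub_le_sub_right ?_ _
  have hint : Integrable (fun ω => ‖gradient (objective ν F) (X ω).1‖ ^ 2) P := by
    refine Integrable.of_bound ((hgradm.comp hX).norm.pow_const 2).aestronglyMeasurable (L ^ 2)
      (ae_of_all _ fun ω => ?_)
    rw [Real.norm_of_nonneg (sq_nonneg _)]
    gcongr
    exact hgb _
  have hint1 : Integrable (fun ω => ‖gradient (objective ν F) (X ω).1‖) P := by
    refine Integrable.of_bound (hgradm.comp hX).norm.aestronglyMeasurable L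
      (ae_of_all _ fun ω => ?_)
    rw [norm_norm]
    exact hgb _
  calc 1 / 2 * ∫ ω, ‖gradient (objective ν F) (X ω).1‖ ^ 2 ∂P - 13 * M ^ 2 * δ ^ 2
      = ∫ ω, (1 / 2 * ‖gradient (objective ν F) (X ω).1‖ ^ 2 - 13 * M ^ 2 * δ ^ 2) ∂P := by
        rw [integral_sub (hint.const_mul _) (integrable_const _), integral_const_mul]
        simp
    _ ≤ _ := by
        refine integral_mono ((hint.const_mul _).sub (integrable_const _))
          (hint.sub (hint1.const_mul _)) fun ω => ?_
        simp only
        nlinarith [sq_nonneg (‖gradient (objective ν F) (X ω).1‖ - 5 * M * δ),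
          sq_nonneg (M * δ)]

theorem integrable_norm_sq_gradient (hL : 0 ≤ L) (hs : IsSampling P ν u ξ)
    (hW : Measurable W) (hF : Measurable (Function.uncurry F)) (hi : ∀ x, Integrable (F x) ν)
    (hlip : ∀ᵐ z ∂ν, ∀ x y, |F x z - F y z| ≤ L * ‖x - y‖) (hf : IsSmooth M (objective ν F))
    (t : ℕ) :
    Integrable (fun ω => ‖gradient (objective ν F)
      (runState W F η δ D x₀ (fun s => u s ω) (fun s => ξ s ω) t).1‖ ^ 2) P ∧
    ∫ ω, ‖gradient (objective ν F)
      (runState W F η δ D x₀ (fun s => u s ω) (fun s => ξ s ω) t).1‖ ^ 2 ∂P ≤ L ^ 2 := by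
  have hgb := norm_gradient_le hL (abs_objective_sub_le hi hlip)
  have hm := (hf.continuous_gradient.measurable.comp (measurable_fst.comp
    (measurable_runState (η := η) (δ := δ) (D := D) (x₀ := x₀) hs hW hF t)))
  have hb : ∀ x, ‖gradient (objective ν F) x‖ ^ 2 ≤ L ^ 2 := fun x => by gcongr; exact hgb x
  have hint : Integrable (fun ω => ‖gradient (objective ν F)
      (runState W F η δ D x₀ (fun s => u s ω) (fun s => ξ s ω) t).1‖ ^ 2) P := by
    refine Integrable.of_bound (hm.norm.pow_const 2).aestronglyMeasurable (L ^ 2)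
      (ae_of_all _ fun ω => ?_)
    rw [Real.norm_of_nonneg (sq_nonneg _)]
    exact hb _
  refine ⟨hint, ?_⟩
  calc _ ≤ ∫ _, L ^ 2 ∂P := integral_mono hint (integrable_const _) fun ω => hb _
    _ = L ^ 2 := by simp

/-- The expected decrease of the objective in one step. -/
theorem integral_objective_step_le (hd : 1 ≤ d) (hL : 0 ≤ L) (hM : 0 < M)
    (hs : IsSampling P ν u ξ)
    (hW : Measurable W) (hF : Measurable (Function.uncurry F)) (hi : ∀ x, Integrable (F x) ν)
    (hlip : ∀ᵐ z ∂ν, ∀ x y, |F x z - F y z| ≤ L * ‖x - y‖) (hf : IsSmooth M (objective ν F))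
    (hc : LazyControl d W η δ D a β) (hdB : d * L ≤ B) (hB : a * B + β ≤ B) (t : ℕ) :
    Integrable (fun ω => objective ν F
      (runState W F η δ D x₀ (fun s => u s ω) (fun s => ξ s ω) t).1) P ∧
    ∫ ω, objective ν F
      (runState W F η δ D x₀ (fun s => u s ω) (fun s => ξ s ω) (t + 1)).1 ∂P ≤
    ∫ ω, objective ν F (runState W F η δ D x₀ (fun s => u s ω) (fun s => ξ s ω) t).1 ∂P -
      η * (1 / 2 * ∫ ω, ‖gradient (objective ν F)
          (runState W F η δ D x₀ (fun s => u s ω) (fun s => ξ s ω) t).1‖ ^ 2 ∂P -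
        13 * M ^ 2 * δ ^ 2 - L * (B + d * L) * asymmetry P W F η δ D x₀ u ξ t) +
      M * (η ^ 2 * (5 / 4 * (23 * (d * L ^ 2) + 2 * β ^ 2))) := by
  have hη := hc.eta_pos
  have hBnn : 0 ≤ B := le_trans (by positivity) hdB
  have hmx : ∀ t, Measurable fun ω =>
      (runState W F η δ D x₀ (fun s => u s ω) (fun s => ξ s ω) t).1 := fun t =>
    measurable_fst.comp (measurable_runState hs hW hF t)
  have hmg := fun t => measurable_runEst (η := η) (δ := δ) (D := D) (x₀ := x₀) hs hW hF t
  set f := objective ν F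
  set x : ℕ → Ω → E d := fun t ω => (runState W F η δ D x₀ (fun s => u s ω) (fun s => ξ s ω) t).1
  set g : ℕ → Ω → E d := fun t ω => runEst W F η δ D x₀ (fun s => u s ω) (fun s => ξ s ω) t
  have hstep : ∀ t ω, x (t + 1) ω = x t ω - η • g t ω := fun t ω => rfl
  have hflip : ∀ y z, |f y - f z| ≤ L * ‖y - z‖ := abs_objective_sub_le hi hlip
  have hgb := norm_gradient_le hL hflip
  have hmf : Measurable f := hf.1.continuous.measurable
  have hgB : ∀ t, ∀ᵐ ω ∂P, ‖g t ω‖ ≤ B := fun t => by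
    filter_upwards [ae_norm_eq_one_and_lipschitz hd hs hlip] with ω hω
    exact hc.norm_runEst_le hω.1 hω.2 hdB hB t
  have hint : ∀ t, Integrable (fun ω => f (x t ω)) P := by
    intro t
    induction t with
    | zero => exact integrable_const (f x₀)
    | succ t ih =>
      have hdiff : Integrable (fun ω => f (x (t + 1) ω) - f (x t ω)) P := by
        refine Integrable.of_bound
          ((hmf.comp (hmx (t + 1))).sub (hmf.comp (hmx t))).aestronglyMeasurable
          (L * (η * B)) ?_
        filter_upwards [hgB t] with ω hω
        refine (hflip _ _).trans ?_
        rw [hstep, sub_sub_cancel_left, norm_neg, norm_smul, Real.norm_of_nonneg hη.le]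
        gcongr
      exact (ih.add hdiff).congr (ae_of_all _ fun ω => by simp)
  refine ⟨hint t, ?_⟩
  obtain ⟨hsqint, hsq⟩ := integral_norm_sq_runEst_le (x₀ := x₀) hd hL hs hW hF hlip hc hdB hB t
  have hbias := le_integral_inner_runEst (x₀ := x₀) hd hL hM hs hW hF hi hlip hf hc hdB hB t
  have hinner : Integrable (fun ω => ⟪gradient f (x t ω), g t ω⟫) P := by
    refine Integrable.of_bound ((hf.continuous_gradient.measurable.comp (hmx t)).inner
      (hmg t)).aestronglyMeasurable (L * B) ?_
    filter_upwards [hgB t] with ω hω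
    refine (norm_inner_le_norm _ _).trans ?_
    gcongr
    exact hgb _
  have hlin : Integrable (fun ω => f (x t ω) - η * ⟪gradient f (x t ω), g t ω⟫) P :=
    (hint t).sub (hinner.const_mul _)
  have hle : ∫ ω, f (x (t + 1) ω) ∂P ≤
      ∫ ω, (f (x t ω) - η * ⟪gradient f (x t ω), g t ω⟫ + M * (η ^ 2 * ‖g t ω‖ ^ 2)) ∂P := by
    refine integral_mono (hint (t + 1))
      (hlin.add ((hsqint.const_mul _).const_mul _)) fun ω => ?_
    have h := hf.le_add_inner_add hM.le (x t ω) (η • g t ω)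
    rw [real_inner_smul_right, norm_smul, mul_pow, Real.norm_of_nonneg hη.le] at h
    exact h
  rw [integral_add hlin ((hsqint.const_mul _).const_mul _),
    integral_sub (hint t) (hinner.const_mul _), integral_const_mul, integral_const_mul,
    integral_const_mul] at hle
  refine hle.trans ?_
  gcongr

/-- The telescoped descent inequality. -/
theorem sum_integral_norm_sq_gradient_le (hd : 1 ≤ d) (hL : 0 ≤ L) (hM : 0 < M)
    (hs : IsSampling P ν u ξ)
    (hW : Measurable W) (hF : Measurable (Function.uncurry F)) (hi : ∀ x, Integrable (F x) ν)
    (hlip : ∀ᵐ z ∂ν, ∀ x y, |F x z - F y z| ≤ L * ‖x - y‖) (hf : IsSmooth M (objective ν F))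
    {Δ : ℝ} (hΔ : ∀ x, objective ν F x₀ - objective ν F x ≤ Δ)
    (hc : LazyControl d W η δ D a β) (hdB : d * L ≤ B) (hB : a * B + β ≤ B) (n : ℕ) :
    η / 2 * ∑ t ∈ Finset.range n, ∫ ω, ‖gradient (objective ν F)
          (runState W F η δ D x₀ (fun s => u s ω) (fun s => ξ s ω) t).1‖ ^ 2 ∂P ≤
      Δ + n * (η * (13 * M ^ 2 * δ ^ 2)) +
        η * (L * (B + d * L)) * ∑ t ∈ Finset.range n, asymmetry P W F η δ D x₀ u ξ t +
        n * (M * (η ^ 2 * (5 / 4 * (23 * (d * L ^ 2) + 2 * β ^ 2)))) := by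
  have hstep := fun t => integral_objective_step_le (x₀ := x₀) hd hL hM hs hW hF hi hlip hf hc hdB
    hB t
  have hind : ∀ n : ℕ, ∫ ω, objective ν F
      (runState W F η δ D x₀ (fun s => u s ω) (fun s => ξ s ω) n).1 ∂P +
      η / 2 * ∑ t ∈ Finset.range n, ∫ ω, ‖gradient (objective ν F)
          (runState W F η δ D x₀ (fun s => u s ω) (fun s => ξ s ω) t).1‖ ^ 2 ∂P ≤
      objective ν F x₀ + n * (η * (13 * M ^ 2 * δ ^ 2)) +
        η * (L * (B + d * L)) * ∑ t ∈ Finset.range n, asymmetry P W F η δ D x₀ u ξ t +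
        n * (M * (η ^ 2 * (5 / 4 * (23 * (d * L ^ 2) + 2 * β ^ 2)))) := by
    intro n
    induction n with
    | zero => simp [runState]
    | succ n ih =>
      rw [Finset.sum_range_succ, Finset.sum_range_succ]
      have h := (hstep n).2
      push_cast
      linarith
  have hlow : objective ν F x₀ - Δ ≤ ∫ ω, objective ν F
      (runState W F η δ D x₀ (fun s => u s ω) (fun s => ξ s ω) n).1 ∂P := by
    calc objective ν F x₀ - Δ = ∫ _, (objective ν F x₀ - Δ) ∂P := by simp
      _ ≤ _ := integral_mono (integrable_const _) (hstep n).1 fun ω => by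
        dsimp only; linarith [hΔ (runState W F η δ D x₀ (fun s => u s ω) (fun s => ξ s ω) n).1]
  linarith [hind n]

end Expectation

/-! ### The regret bound -/

section Regret

/-- The constant of the regret bound, for the Lipschitz constant `L`, the smoothness constant `M`, the
initial gap `Δ` and the implied constants `cD` and `cA`. -/
def regretConst (L M Δ cD cA : ℝ) : ℝ :=
  2 * L * Δ + 52 * M ^ 2 + 2 * L ^ 2 * (2 + 3 * cD) * cA + 5 * M * (23 + 8 * cD ^ 2) * L + 2 * L ^ 2

theorem regretConst_nonneg {L M Δ cD cA : ℝ} (hL : 0 ≤ L) (hM : 0 ≤ M) (hΔ : 0 ≤ Δ) (hcD : 0 ≤ cD)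
    (hcA : 0 ≤ cA) : 0 ≤ regretConst L M Δ cD cA := by
  unfold regretConst; positivity

/-- The choice of the step size and of the smoothing radius. -/
theorem smoothing_radius_eq {d T : ℕ} (hd : 1 ≤ d) (hT : 1 ≤ T) {L η δ : ℝ} (hL : 0 < L)
    (hη : η = 1 / (L * √((d : ℝ) * T))) (hδ : δ = √((d : ℝ) / T)) : δ = d * L * η := by
  have hd' : (0 : ℝ) < d := by positivity
  have hT' : (0 : ℝ) < T := by positivity
  rw [hη, hδ, Real.sqrt_div hd'.le, Real.sqrt_mul hd'.le]
  have h1 : √(d : ℝ) ≠ 0 := by positivity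
  have h2 : √(T : ℝ) ≠ 0 := by positivity
  field_simp
  rw [Real.sq_sqrt hd'.le]

/-- Substituting the step size and the smoothing radius into the telescoped descent inequality. -/
theorem le_regretConst_mul {d T : ℕ} (hd : 1 ≤ d) (hdT : d ≤ T) {L M Δ cD cA η δ β S p : ℝ}
    (hL : 0 < L) (hM : 0 < M) (hcD : 0 ≤ cD)
    (hη : η = 1 / (L * √((d : ℝ) * T))) (hδ : δ = √((d : ℝ) / T))
    (hβ : β ^ 2 ≤ 4 * cD ^ 2 * L ^ 2 * d) (hp : p ≤ cA * √((T : ℝ) / d))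
    (hS : η / 2 * S ≤ Δ + (T + 1 : ℕ) * (η * (13 * M ^ 2 * δ ^ 2)) +
      η * (L * ((1 + 3 * cD) * (d * L) + d * L)) * p +
      (T + 1 : ℕ) * (M * (η ^ 2 * (5 / 4 * (23 * (d * L ^ 2) + 2 * β ^ 2))))) :
    S ≤ regretConst L M Δ cD cA * √((d : ℝ) * T) := by
  have hd' : (0 : ℝ) < d := by positivity
  have hT : 1 ≤ T := hd.trans hdT
  have hT' : (0 : ℝ) < T := by positivity
  have hT1 : ((T + 1 : ℕ) : ℝ) ≤ 2 * T := by
    have : (1 : ℝ) ≤ T := by exact_mod_cast hT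
    push_cast; linarith
  set R := √((d : ℝ) * T) with hR
  have hRpos : 0 < R := Real.sqrt_pos.2 (by positivity)
  have hRsq : R ^ 2 = d * T := Real.sq_sqrt (by positivity)
  have hdR : (d : ℝ) ≤ R := Real.le_sqrt_of_sq_le (by
    have : (d : ℝ) ≤ T := by exact_mod_cast hdT
    nlinarith)
  have hδsq : δ ^ 2 = d / T := by rw [hδ]; exact Real.sq_sqrt (by positivity)
  have hroot : d * √((T : ℝ) / d) = R := by
    rw [hR, ← Real.sqrt_sq hd'.le, ← Real.sqrt_mul (by positivity), Real.sqrt_sq hd'.le]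
    congr 1
    field_simp
  have hηpos : 0 < η := by rw [hη]; positivity
  have hLη : L * R * η = 1 := by rw [hη]; field_simp
  have e1 : (T + 1 : ℕ) * (13 * M ^ 2 * δ ^ 2) ≤ 26 * M ^ 2 * R := by
    calc ((T + 1 : ℕ) : ℝ) * (13 * M ^ 2 * δ ^ 2) ≤ 2 * T * (13 * M ^ 2 * δ ^ 2) := by gcongr
      _ = 26 * M ^ 2 * d := by rw [hδsq]; field_simp; norm_num
      _ ≤ _ := by gcongr
  have e2 : L * ((1 + 3 * cD) * (d * L) + d * L) * p ≤ L ^ 2 * (2 + 3 * cD) * cA * R := by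
    calc L * ((1 + 3 * cD) * (d * L) + d * L) * p
        ≤ L * ((1 + 3 * cD) * (d * L) + d * L) * (cA * √((T : ℝ) / d)) := by gcongr
      _ = L ^ 2 * (2 + 3 * cD) * cA * (d * √((T : ℝ) / d)) := by ring
      _ = _ := by rw [hroot]
  have e3 : (T + 1 : ℕ) * (M * (η * (5 / 4 * (23 * (d * L ^ 2) + 2 * β ^ 2)))) ≤
      5 / 2 * M * (23 + 8 * cD ^ 2) * L * R := by
    have hTη : T * d * η * L = R := by
      have : R * (L * R * η) = R := by rw [hLη, mul_one]
      calc T * d * η * L = R ^ 2 * η * L := by rw [hRsq]; ring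
        _ = R * (L * R * η) := by ring
        _ = R := this
    calc (T + 1 : ℕ) * (M * (η * (5 / 4 * (23 * (d * L ^ 2) + 2 * β ^ 2))))
        ≤ 2 * T * (M * (η * (5 / 4 * (23 * (d * L ^ 2) + 2 * (4 * cD ^ 2 * L ^ 2 * d))))) := by
          gcongr
      _ = 5 / 2 * M * (23 + 8 * cD ^ 2) * L * (T * d * η * L) := by ring
      _ = _ := by rw [hTη]
  have e0 : Δ = η * (L * R * Δ) := by
    calc Δ = L * R * η * Δ := by rw [hLη, one_mul]
      _ = _ := by ring
  have hS' : η * (S / 2) ≤ η * (L * R * Δ + 26 * M ^ 2 * R + L ^ 2 * (2 + 3 * cD) * cA * R +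
      5 / 2 * M * (23 + 8 * cD ^ 2) * L * R) := by
    calc η * (S / 2) = η / 2 * S := by ring
      _ ≤ _ := hS
      _ = η * (L * R * Δ + (T + 1 : ℕ) * (13 * M ^ 2 * δ ^ 2) +
          L * ((1 + 3 * cD) * (d * L) + d * L) * p +
          (T + 1 : ℕ) * (M * (η * (5 / 4 * (23 * (d * L ^ 2) + 2 * β ^ 2))))) := by
          linear_combination e0
      _ ≤ _ := by gcongr
  have hfin := le_of_mul_le_mul_left hS' hηpos
  have hlast : 0 ≤ 2 * L ^ 2 * R := by positivity
  rw [regretConst]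
  linarith

variable {d T : ℕ} {Ω Ξ : Type*} [MeasurableSpace Ω] [MeasurableSpace Ξ] {P : Measure Ω}
  [IsProbabilityMeasure P] {ν : Measure Ξ} [IsProbabilityMeasure ν]
  {W : ℝ × ℝ × E d × E d → ℝ≥0∞} {V : Variation d} {F : E d → Ξ → ℝ} {η δ D : ℝ} {x₀ : E d}
  {u : ℕ → Ω → E d} {ξ : ℕ → Ω → Ξ} {L M a β Δ cD cA : ℝ}

/-- The regret bound for every variation `W` whose lazy queries are under control; the two variations
of the theorem are instances. -/
theorem regretBound_of_lazyControl (hd : 1 ≤ d) (hT : 1 ≤ T) (hL : 0 < L) (hM : 0 < M)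
    (hΔ0 : 0 ≤ Δ) (hcD : 0 ≤ cD) (hcA : 0 ≤ cA)
    (hF : Measurable (Function.uncurry F)) (hi : ∀ x, Integrable (F x) ν)
    (hlip : ∀ᵐ z ∂ν, ∀ x y, |F x z - F y z| ≤ L * ‖x - y‖) (hf : IsSmooth M (objective ν F))
    (hΔ : ∀ x, objective ν F x₀ - objective ν F x ≤ Δ) (hs : IsSampling P ν u ξ)
    (hη : η = 1 / (L * √((d : ℝ) * T))) (hδ : δ = √((d : ℝ) / T))
    (hV : ∀ f g x y, V f g x y = W (f x, g y, x, y)) (hW : Measurable W)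
    (hc : LazyControl d W η δ D a β) (hβ0 : 0 ≤ β) (hβ : β ≤ 2 * cD * L * √(d : ℝ))
    (hasym : totalAsymmetry P V F η δ D x₀ u ξ T ≤ cA * √((T : ℝ) / d)) :
    RegretBound P ν V F η δ D x₀ u ξ T (regretConst L M Δ cD cA)
      (regretConst L M Δ cD cA ^ 2) := by
  have hd' : (0 : ℝ) < d := by positivity
  have hT' : (0 : ℝ) < T := by positivity
  have hd1 : (1 : ℝ) ≤ d := by exact_mod_cast hd
  have hC := regretConst_nonneg hL.le hM.le hΔ0 hcD hcA
  have hgs : ∀ t ω, gradSq ν V F η δ D x₀ u ξ t ω = ‖gradient (objective ν F)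
      (runState W F η δ D x₀ (fun s => u s ω) (fun s => ξ s ω) t).1‖ ^ 2 := fun t ω => by
    rw [gradSq, runState_fst hV]
  have hgrad := fun t => integrable_norm_sq_gradient (η := η) (δ := δ) (D := D) (x₀ := x₀) hL.le hs
    hW hF hi hlip hf t
  have hbound : ncRegret P ν V F η δ D x₀ u ξ T ≤
      regretConst L M Δ cD cA * √((d : ℝ) * T) := by
    simp only [ncRegret, hgs]
    -- for `T < d` the bound follows from `‖∇f‖ ≤ L`, because then `T ≤ √(d T)`
    rcases le_or_gt d T with hdT | hdT
    · have ha : a ≤ 1 / 3 := by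
        by_contra h
        have := hc.sq_le
        nlinarith [not_le.1 h]
      have hsqrt : √(d : ℝ) ≤ d := Real.sqrt_le_iff.2 ⟨hd'.le, by nlinarith⟩
      have hB1 : d * L ≤ (1 + 3 * cD) * (d * L) := by
        have : 0 ≤ cD * (d * L) := by positivity
        linarith
      have hB2 : a * ((1 + 3 * cD) * (d * L)) + β ≤ (1 + 3 * cD) * (d * L) := by
        have h1 : a * ((1 + 3 * cD) * (d * L)) ≤ 1 / 3 * ((1 + 3 * cD) * (d * L)) := by gcongr
        have h2 : 2 * cD * L * √(d : ℝ) ≤ 2 * cD * L * d := by gcongr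
        have h3 : 0 < d * L := by positivity
        linarith
      have hsum := sum_integral_norm_sq_gradient_le hd hL.le hM hs hW hF hi hlip hf hΔ hc hB1 hB2
        (T + 1)
      rw [sum_asymmetry hV] at hsum
      refine le_regretConst_mul hd hdT hL hM hcD hη hδ ?_ hasym hsum
      calc β ^ 2 ≤ (2 * cD * L * √(d : ℝ)) ^ 2 := by gcongr
        _ = _ := by rw [mul_pow, Real.sq_sqrt hd'.le]; ring
    · have hTR : (T : ℝ) ≤ √((d : ℝ) * T) := Real.le_sqrt_of_sq_le (by
        have : (T : ℝ) ≤ d := by exact_mod_cast hdT.le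
        nlinarith)
      have hT1 : (1 : ℝ) ≤ T := by exact_mod_cast hT
      have hrest : 2 * L ^ 2 ≤ regretConst L M Δ cD cA := by
        have : 0 ≤ 2 * L * Δ + 52 * M ^ 2 + 2 * L ^ 2 * (2 + 3 * cD) * cA +
          5 * M * (23 + 8 * cD ^ 2) * L := by positivity
        rw [regretConst]
        linarith
      calc _ ≤ ∑ _t ∈ Finset.range (T + 1), L ^ 2 := Finset.sum_le_sum fun t _ => (hgrad t).2
        _ = (T + 1) * L ^ 2 := by
          rw [Finset.sum_const, Finset.card_range, nsmul_eq_mul]; push_cast; ring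
        _ ≤ (T + T) * L ^ 2 := by gcongr
        _ = 2 * L ^ 2 * T := by ring
        _ ≤ _ := by gcongr
  refine ⟨fun t _ => ?_, hbound, fun ε hε hK => ?_⟩
  · exact (hgrad t).1.congr (ae_of_all _ fun ω => (hgs t ω).symm)
  · rw [div_le_iff₀ hT']
    refine hbound.trans ?_
    rw [div_le_iff₀ (by positivity)] at hK
    refine abs_le_of_sq_le_sq' ?_ (by positivity) |>.2
    rw [mul_pow, Real.sq_sqrt (by positivity)]
    nlinarith

end Regret

section Variations

variable {d T : ℕ} {L η δ D : ℝ}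

theorem le_mul_of_ofReal_div_le {p q c : ℝ} (hq : 0 ≤ q) (hc : 0 ≤ c)
    (h : ENNReal.ofReal p / ENNReal.ofReal q ≤ ENNReal.ofReal c) : p ≤ c * q := by
  rcases hq.eq_or_lt with rfl | hq'
  · by_contra hp
    rw [mul_zero, not_le] at hp
    rw [ENNReal.ofReal_zero, ENNReal.div_zero (ENNReal.ofReal_pos.2 hp).ne'] at h
    exact ENNReal.ofReal_ne_top (top_le_iff.1 h)
  · rw [← ENNReal.ofReal_div_of_pos hq', ENNReal.ofReal_le_ofReal_iff hc, div_le_iff₀ hq'] at h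
    exact h

/-- For the variation `|f x - g y| / ‖x - y‖`, the lazy estimator is at most `D / L` times the
previous estimator plus `2 d D`. -/
theorem lazyControl_variationA (hd : 1 ≤ d) (hL : 0 < L) (hη : 0 < η) (hδ : δ = d * L * η)
    (hD : 0 ≤ D) (hDL : D < L / √10) :
    LazyControl d (fun q => ENNReal.ofReal |q.1 - q.2.1| / ENNReal.ofReal ‖q.2.2.1 - q.2.2.2‖)
      η δ D (D / L) (2 * d * D) where
  eta_pos := hη
  delta_pos := by rw [hδ]; positivity
  nonneg := by positivity
  sq_le := by
    rw [lt_div_iff₀ (by positivity)] at hDL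
    have h : (D * √10) ^ 2 ≤ L ^ 2 := by gcongr
    rw [mul_pow, Real.sq_sqrt (by norm_num)] at h
    rw [div_pow, ← mul_div_assoc, div_le_one (by positivity)]
    linarith
  bound r s x y h := by
    have h1 := le_mul_of_ofReal_div_le (norm_nonneg (x - y)) hD h
    have hd' : (0 : ℝ) < d := by positivity
    calc d / δ * |r - s| ≤ d / δ * (D * ‖x - y‖) := by
          have : 0 < δ := by rw [hδ]; positivity
          gcongr
      _ = _ := by rw [hδ]; field_simp; ring

/-- For the variation `|f x - g y| / (η L)`, the lazy estimator is at most `D`. -/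
theorem lazyControl_variationB (hd : 1 ≤ d) (hL : 0 < L) (hη : 0 < η) (hδ : δ = d * L * η)
    (hD : 0 ≤ D) :
    LazyControl d (fun q => ENNReal.ofReal |q.1 - q.2.1| / ENNReal.ofReal (η * L))
      η δ D 0 D where
  eta_pos := hη
  delta_pos := by rw [hδ]; positivity
  nonneg := le_rfl
  sq_le := by norm_num
  bound r s x y h := by
    have h1 := le_mul_of_ofReal_div_le (by positivity) hD h
    have hd' : (0 : ℝ) < d := by positivity
    calc d / δ * |r - s| ≤ d / δ * (D * (η * L)) := by
          have : 0 < δ := by rw [hδ]; positivity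
          gcongr
      _ = _ := by rw [hδ]; field_simp; ring

end Variations

end

end LAZO

open MeasureTheory LAZO in
/-- The constants `C`, `K` depend only on the Lipschitz constant `L`, the smoothness constant `μ`,
a bound `Δ` for `f(x₀) - inf f`, and the implied constants `cD`, `cA` of the assumptions
`D = O(L/√d)` or `D = O(√d L)`, and `∑ ℙ(A_t \ A_t^s) = O(√(T/d))`. -/
theorem theorem2 (L μ Δ cD cA : ℝ) (hL : 0 < L) :
    ∃ C K : ℝ, ∀ (d T : ℕ), 1 ≤ d → 1 ≤ T →
      ∀ (Ω Ξ : Type*) [MeasurableSpace Ω] [MeasurableSpace Ξ]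
        (P : Measure Ω) [IsProbabilityMeasure P] (ν : Measure Ξ) [IsProbabilityMeasure ν]
        (F : E d → Ξ → ℝ) (x₀ : E d) (u : ℕ → Ω → E d) (ξ : ℕ → Ω → Ξ) (η δ D : ℝ),
        Measurable (Function.uncurry F) →
        (∀ x, Integrable (F x) ν) →
        (∀ᵐ z ∂ν, ∀ x y, |F x z - F y z| ≤ L * ‖x - y‖) →
        IsSmooth μ (objective ν F) →
        (∀ x, objective ν F x₀ - objective ν F x ≤ Δ) →
        IsSampling P ν u ξ →
        η = 1 / (L * √((d : ℝ) * T)) →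
        δ = √((d : ℝ) / T) →
        0 < D →
        (D ≤ cD * (L / √(d : ℝ)) → D < L / √10 →
          totalAsymmetry P (variationA d) F η δ D x₀ u ξ T ≤ cA * √((T : ℝ) / d) →
          RegretBound P ν (variationA d) F η δ D x₀ u ξ T C K) ∧
        (D ≤ cD * (√(d : ℝ) * L) →
          totalAsymmetry P (variationB d η L) F η δ D x₀ u ξ T ≤ cA * √((T : ℝ) / d) →
          RegretBound P ν (variationB d η L) F η δ D x₀ u ξ T C K) := by
  -- absolute values make the constants nonnegative, and `|μ| + 1` is a positive smoothness constant
  refine ⟨regretConst L (|μ| + 1) Δ |cD| |cA|, regretConst L (|μ| + 1) Δ |cD| |cA| ^ 2, ?_⟩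
  intro d T hd hT Ω Ξ _ _ P _ ν _ F x₀ u ξ η δ D hF hi hlip hf hΔ hs hη hδ hD
  have hd' : (0 : ℝ) < d := by positivity
  have hT' : (0 : ℝ) < T := by positivity
  have hηpos : 0 < η := by rw [hη]; positivity
  have hδη := smoothing_radius_eq hd hT hL hη hδ
  have hΔ0 : 0 ≤ Δ := by simpa using hΔ x₀
  have hf' : IsSmooth (|μ| + 1) (objective ν F) :=
    hf.mono ((le_abs_self μ).trans (le_add_of_nonneg_right zero_le_one))
  have hcA : cA * √((T : ℝ) / d) ≤ |cA| * √((T : ℝ) / d) := by gcongr; exact le_abs_self cA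
  constructor
  · intro hDc hDL hasym
    refine regretBound_of_lazyControl hd hT hL (by positivity) hΔ0 (abs_nonneg cD) (abs_nonneg cA)
      hF hi hlip hf' hΔ hs hη hδ (fun f g x y => rfl) (by fun_prop)
      (lazyControl_variationA hd hL hηpos hδη hD.le hDL) (by positivity) ?_ (hasym.trans hcA)
    have h1 : D ≤ |cD| * (L / √(d : ℝ)) := hDc.trans (by gcongr; exact le_abs_self cD)
    calc 2 * d * D ≤ 2 * d * (|cD| * (L / √(d : ℝ))) := by gcongr
      _ = 2 * |cD| * L * (d / √(d : ℝ)) := by ring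
      _ = _ := by rw [Real.div_sqrt]
  · intro hDc hasym
    refine regretBound_of_lazyControl hd hT hL (by positivity) hΔ0 (abs_nonneg cD) (abs_nonneg cA)
      hF hi hlip hf' hΔ hs hη hδ (fun f g x y => rfl) (by fun_prop)
      (lazyControl_variationB hd hL hηpos hδη hD.le) hD.le ?_ (hasym.trans hcA)
    have h1 : D ≤ |cD| * (√(d : ℝ) * L) := hDc.trans (by gcongr; exact le_abs_self cD)
    have h2 : 0 ≤ |cD| * (√(d : ℝ) * L) := by positivity
    linarith
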